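/- Two metric spaces $X,Y$ are coarsely equivalent if there are maps $f:X\to Y$ and $g:Y\to X$ and a constant $K$ such that $f$ and $g$ are bornologous (for every $\delta<\infty$ the distances between images of points at distance $\le\delta$ are bounded), $\mathrm{dist}(g(f(x)),x)\le K$ for all $x\in X$ and $\mathrm{dist}(f(g(y)),y)\le K$ for all $y\in Y$. We write $\mathrm{asdim}(X)\le n$ if for every $D\ge 0$ the space $X$ has a cover $\mathcal U=\mathcal U_0\cup\dots\cup\mathcal U_n$ by sets of uniformly bounded diameter such that for each $i\le n$ any two distinct members of $\mathcal U_i$ are at distance $\ge D$; $\mathrm{asdim}(X)\in\{0,1,2,\dots\}\cup\{\infty\}$ is the smallest such $n$, or $\infty$ if there is none. The space $X$ is large scale connected if for some $\varepsilon\ge 0$ any two points $x,y\in X$ can be linked by a finite chain $x=x_0,x_1,\dots,x_m=y$ with $\mathrm{dist}(x_{i},x_{i+1})\le\varepsilon$ for all $i<m$. Countable groups are considered as metric spaces with respect to proper (all closed balls are compact) left-invariant metrics. $\mathbb Z^\infty$ denotes the direct sum of countably many copies of $\mathbb Z$. **Statement.** Let $X$ be a metric space of asymptotic dimension $n=\mathrm{asdim}(X)\in\{0,1,2,\dots\}\cup\{\infty\}$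 that is coarsely equivalent to a countable abelian group endowed with some proper left-invariant metric. The groups $\mathbb Z^n$ and $\mathbb Z^n\oplus(\mathbb Q/\mathbb Z)$ admit proper left-invariant metrics, and for every choice of such metrics on them: 1. if $X$ is large scale connected, then $X$ is coarsely equivalent to $\mathbb Z^n$; if $n<\infty$, then conversely $X$ is large scale connected whenever it is coarsely equivalent to $\mathbb Z^n$; 2. $X$ is coarsely equivalent to $\mathbb Z^n\oplus(\mathbb Q/\mathbb Z)$ if and only if $X$ is not large scale connected. -/

import Mathlib

/-- A map `f` between metric spaces is bornologous if for every `δ` there is a finite bound on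
the distances `dist (f x) (f y)` over all points with `dist x y ≤ δ` (equivalently, the continuity
modulus of `f` is finite at every `δ < ∞`). -/
def Bornologous {X Y : Type*} [PseudoMetricSpace X] [PseudoMetricSpace Y] (f : X → Y) : Prop :=
  ∀ δ : ℝ, ∃ R : ℝ, ∀ x y : X, dist x y ≤ δ → dist (f x) (f y) ≤ R

/-- Two metric spaces are coarsely equivalent if there are bornologous maps in both directions
whose compositions are at bounded distance from the identity maps. -/
def CoarselyEquivalent (X Y : Type*) [PseudoMetricSpace X] [PseudoMetricSpace Y] : Prop :=
  ∃ (f : X → Y) (g : Y → X), Bornologous f ∧ Bornologous g ∧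
    ∃ K : ℝ, (∀ x, dist (g (f x)) x ≤ K) ∧ (∀ y, dist (f (g y)) y ≤ K)

/-- `asdim X ≤ n`: for every `D ≥ 0` there is a cover of `X` by sets of uniformly bounded diameter
that is the union of `n + 1` subfamilies, each of which is `D`-discrete. -/
def AsdimLE (X : Type*) [PseudoMetricSpace X] (n : ℕ) : Prop :=
  ∀ D : ℝ, 0 ≤ D → ∃ U : Fin (n + 1) → Set (Set X),
    (∀ x : X, ∃ i, ∃ A ∈ U i, x ∈ A) ∧
    (∃ R : ℝ, ∀ i, ∀ A ∈ U i, ∀ x ∈ A, ∀ y ∈ A, dist x y ≤ R) ∧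
    (∀ i, ∀ A ∈ U i, ∀ B ∈ U i, A ≠ B → ∀ a ∈ A, ∀ b ∈ B, D ≤ dist a b)

/-- The asymptotic dimension: the smallest `n` with `asdim X ≤ n`, and `⊤` if there is none. -/
noncomputable def asdim (X : Type*) [PseudoMetricSpace X] : ℕ∞ :=
  ⨅ (n : ℕ) (_ : AsdimLE X n), (n : ℕ∞)

/-- Any two points of `X` are linked by a finite chain `x = x₀, x₁, …, xₘ = y` in which
consecutive points are at distance at most `ε`. -/
def EpsConnected (X : Type*) [PseudoMetricSpace X] (ε : ℝ) : Prop :=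
  ∀ x y : X, ∃ (m : ℕ) (c : ℕ → X), c 0 = x ∧ c m = y ∧ ∀ i < m, dist (c i) (c (i + 1)) ≤ ε

def LargeScaleConnected (X : Type*) [PseudoMetricSpace X] : Prop :=
  ∃ ε : ℝ, 0 ≤ ε ∧ EpsConnected X ε

/-- A metric on the group `G` (written additively) that is left-invariant and proper: its closed
balls are compact in the topology of the metric. -/
structure ProperLeftInvariantMetric (G : Type*) [AddGroup G] extends MetricSpace G where
  proper : ProperSpace G
  left_invariant : ∀ a x y : G, dist (a + x) (a + y) = dist x y

/-- The metric space `X` is coarsely equivalent to the group `G` endowed with the metric `d`. -/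
def CoarselyEquivalentToGroup (X : Type*) [PseudoMetricSpace X] {G : Type*} [AddGroup G]
    (d : ProperLeftInvariantMetric G) : Prop :=
  letI : MetricSpace G := d.toMetricSpace
  CoarselyEquivalent X G

/-- The free abelian group `ℤⁿ`, for `n` finite or infinite: the direct sum of copies of `ℤ`
indexed by the natural numbers `k < n`. For `n = ⊤` it is the direct sum of countably many copies
of `ℤ`. -/
abbrev IntPow (n : ℕ∞) : Type := {k : ℕ // (k : ℕ∞) < n} →₀ ℤ

/-- The group `ℚ/ℤ`. -/
abbrev RatModInt : Type := ℚ ⧸ AddSubgroup.zmultiples (1 : ℚ)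

/-! In a countable group with a proper left-invariant metric, closed balls are finite. So whether a
map between such groups is bornologous depends only on finite sets of differences, and the choice of
metrics plays no role.

Let `G` be a countable abelian group of torsion-free rank `r`, and `F` a free subgroup of rank `r`
with torsion quotient. Representing each coset of `F` by an element whose rational coordinates lie
in `[0, 1)` gives a bijection of `G` with `F × G/F`. It is not a homomorphism, but it and its
inverse carry finite sets of differences to finite ones (`groupCoarselyEquivalent_prod_quotient`).
If `G` is finitely generated, `G/F` is finite and drops out. Otherwise `F` is replaced by `2F`,
whose quotient is always infinite, and that quotient is exchanged for `ℚ/ℤ`.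

The exchange is possible because all infinite countable torsion abelian groups are coarsely
equivalent (`groupCoarselyEquivalent_of_torsion`). Such a group is enumerated by `ℕ` so that the
cosets of an exhausting chain of finite subgroups become intervals, and two such systems of
intervals are matched by an increasing function.

It remains to recognise the data in `X`. Large scale connectedness is a coarse invariant that means
finite generation for `G`, and `asdim` is a coarse invariant equal to `r` (`asdim_eq_rank`). The
upper bound is a colouring of bricks in `ℤ^r`. The lower bound is a Lebesgue covering argument: too
few families of tiles would give bounded perturbations of the coordinates of a lattice whose
differentials have zero product on every cube. The integral of this product over a large discrete
torus must nevertheless be its volume, up to a boundary error (`sum_prod_closed_forms`). -/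

/-! ### Coarse invariance of large scale connectedness and asymptotic dimension. -/

theorem CoarselyEquivalent.symm {X Y : Type*} [PseudoMetricSpace X] [PseudoMetricSpace Y]
    (h : CoarselyEquivalent X Y) : CoarselyEquivalent Y X := by
  obtain ⟨f, g, hf, hg, K, h1, h2⟩ := h
  exact ⟨g, f, hg, hf, K, h2, h1⟩

theorem CoarselyEquivalent.trans {X Y Z : Type*} [PseudoMetricSpace X] [PseudoMetricSpace Y]
    [PseudoMetricSpace Z] (h : CoarselyEquivalent X Y) (h' : CoarselyEquivalent Y Z) :
    CoarselyEquivalent X Z := by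
  obtain ⟨f, g, hf, hg, K, h1, h2⟩ := h
  obtain ⟨f', g', hf', hg', K', h1', h2'⟩ := h'
  obtain ⟨R, hR⟩ := hg K'
  obtain ⟨S, hS⟩ := hf' K
  refine ⟨f' ∘ f, g ∘ g', ?_, ?_, max (R + K) (S + K'), fun x => ?_, fun z => ?_⟩
  · intro δ
    obtain ⟨R, hR⟩ := hf δ
    obtain ⟨S, hS⟩ := hf' R
    exact ⟨S, fun x y hxy => hS _ _ (hR _ _ hxy)⟩
  · intro δ
    obtain ⟨R, hR⟩ := hg' δ
    obtain ⟨S, hS⟩ := hg R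
    exact ⟨S, fun x y hxy => hS _ _ (hR _ _ hxy)⟩
  · refine le_trans (dist_triangle _ (g (f x)) _) (le_trans ?_ (le_max_left _ _))
    exact add_le_add (hR _ _ (h1' _)) (h1 x)
  · refine le_trans (dist_triangle _ (f' (g' z)) _) (le_trans ?_ (le_max_right _ _))
    exact add_le_add (hS _ _ (h2 _)) (h2' z)

theorem epsConnected_iff_reflTransGen {X : Type*} [PseudoMetricSpace X] {ε : ℝ} :
    EpsConnected X ε ↔ ∀ x y : X, Relation.ReflTransGen (fun a b => dist a b ≤ ε) x y := by
  constructor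
  · intro h x y
    obtain ⟨m, c, rfl, rfl, hc⟩ := h x y
    have : ∀ i ≤ m, Relation.ReflTransGen (fun a b => dist a b ≤ ε) (c 0) (c i) := by
      intro i
      induction i with
      | zero => intro _; exact Relation.ReflTransGen.refl
      | succ i ih => intro hi; exact (ih (by omega)).tail (hc i (by omega))
    exact this m le_rfl
  · intro h x y
    induction h x y with
    | refl => exact ⟨0, fun _ => x, rfl, rfl, fun i hi => absurd hi (by omega)⟩
    | @tail b c _ hbc ih =>
      obtain ⟨m, p, h0, hm, hp⟩ := ih
      refine ⟨m + 1, fun i => if i ≤ m then p i else c, by simpa using h0, by simp, ?_⟩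
      intro i hi
      rcases Nat.lt_or_eq_of_le (Nat.lt_succ_iff.mp hi) with h' | rfl
      · have h1 : i ≤ m := h'.le
        have h2 : i + 1 ≤ m := h'
        simpa [h1, h2] using hp i h'
      · simpa [hm] using hbc

theorem LargeScaleConnected.of_coarselyEquivalent {X Y : Type*} [PseudoMetricSpace X]
    [PseudoMetricSpace Y] (h : CoarselyEquivalent X Y) (hX : LargeScaleConnected X) :
    LargeScaleConnected Y := by
  obtain ⟨f, g, hf, hg, K, h1, h2⟩ := h
  obtain ⟨ε, hε, hX⟩ := hX
  rw [epsConnected_iff_reflTransGen] at hX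
  obtain ⟨R, hR⟩ := hf ε
  refine ⟨max 0 (max R K), le_max_left _ _, epsConnected_iff_reflTransGen.2 fun y y' => ?_⟩
  have hK : K ≤ max 0 (max R K) := le_trans (le_max_right _ _) (le_max_right _ _)
  have hR' : R ≤ max 0 (max R K) := le_trans (le_max_left _ _) (le_max_right _ _)
  refine Relation.ReflTransGen.head (b := f (g y)) ?_ (Relation.ReflTransGen.tail
    (b := f (g y')) ((hX (g y) (g y')).lift f fun a b hab => (hR a b hab).trans hR') ?_)
  · rw [dist_comm]; exact (h2 y).trans hK
  · exact (h2 y').trans hK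

theorem AsdimLE.of_coarselyEquivalent {X Y : Type*} [PseudoMetricSpace X]
    [PseudoMetricSpace Y] (h : CoarselyEquivalent X Y) {n : ℕ} (hY : AsdimLE Y n) :
    AsdimLE X n := by
  obtain ⟨f, g, hf, hg, K, h1, h2⟩ := h
  intro D hD
  obtain ⟨R, hR⟩ := hf D
  -- Any scale above `R` works: points of `X` closer than `D` have images at distance at most `R`,
  -- which therefore lie in no two distinct tiles of one family.
  obtain ⟨U, hc, ⟨S, hS⟩, hd⟩ := hY (max R 0 + 1) (by positivity)
  obtain ⟨S', hS'⟩ := hg S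
  refine ⟨fun i => (fun A => f ⁻¹' A) '' U i, fun x => ?_, ⟨K + S' + K, ?_⟩, ?_⟩
  · obtain ⟨i, A, hA, hx⟩ := hc (f x)
    exact ⟨i, _, ⟨A, hA, rfl⟩, hx⟩
  · rintro i _ ⟨A, hA, rfl⟩ x hx y hy
    have e1 := hS' _ _ (hS i A hA _ hx _ hy)
    have e2 := h1 x
    have e3 := h1 y
    have e4 := dist_triangle4 x (g (f x)) (g (f y)) y
    rw [dist_comm] at e2
    linarith
  · rintro i _ ⟨A, hA, rfl⟩ _ ⟨B, hB, rfl⟩ hAB a ha b hb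
    have e1 := hd i A hA B hB (fun h => hAB (by rw [h])) _ ha _ hb
    by_contra hlt
    have e2 := hR a b (not_le.1 hlt).le
    have e3 := le_max_left R 0
    linarith

/-! ### Coarse equivalence of groups through finite sets of differences. -/

/-- By Baire, a countable complete space has an isolated point. Translations make every point
isolated, and compact discrete sets are finite. -/
theorem finite_closedBall_of_countable {G : Type*} [AddGroup G] [Countable G] [MetricSpace G]
    [ProperSpace G] (hinv : ∀ a x y : G, dist (a + x) (a + y) = dist x y) (x : G) (r : ℝ) :
    (Metric.closedBall x r).Finite := by
  have hd : DiscreteTopology G := by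
    obtain ⟨a, ha⟩ := nonempty_interior_of_iUnion_of_closed (f := fun a : G => ({a} : Set G))
      (fun a => isClosed_singleton) (by ext; simp)
    obtain ⟨b, hb⟩ := ha
    have hab : b = a := Set.mem_singleton_iff.1 (interior_subset hb)
    subst hab
    obtain ⟨ε, hε, hball⟩ := Metric.mem_nhds_iff.1 (mem_interior_iff_mem_nhds.1 hb)
    refine discreteTopology_iff_isOpen_singleton.2 fun c => Metric.isOpen_iff.2 fun y hy => ?_
    rw [Set.mem_singleton_iff] at hy
    subst hy
    refine ⟨ε, hε, fun z hz => ?_⟩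
    have : (b + -y) + z ∈ Metric.ball b ε := by
      have h := hinv (b + -y) z y
      rw [Metric.mem_ball] at hz ⊢
      simpa using h.trans_lt hz
    have h2 := hball this
    rw [Set.mem_singleton_iff] at h2 ⊢
    rw [add_assoc, add_eq_left, neg_add_eq_zero] at h2
    exact h2.symm
  exact (isCompact_closedBall x r).finite_of_discrete

/-- The bornologous maps of abelian groups, in terms of finite sets of differences. -/
def GroupBornologous {G H : Type*} [AddCommGroup G] [AddCommGroup H] (f : G → H) : Prop :=
  ∀ F : Set G, F.Finite → ∃ E : Set H, E.Finite ∧ ∀ x y, y - x ∈ F → f y - f x ∈ E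

/-- Coarse equivalence of abelian groups, in terms of finite sets of differences. -/
def GroupCoarselyEquivalent (G H : Type*) [AddCommGroup G] [AddCommGroup H] : Prop :=
  ∃ (f : G → H) (g : H → G), GroupBornologous f ∧ GroupBornologous g ∧
    (∃ F : Set G, F.Finite ∧ ∀ x, g (f x) - x ∈ F) ∧ ∃ E : Set H, E.Finite ∧ ∀ y, f (g y) - y ∈ E

section

variable {G H K L : Type*} [AddCommGroup G] [AddCommGroup H] [AddCommGroup K] [AddCommGroup L]

theorem groupBornologous_of_singleton {f : G → H}
    (h : ∀ u : G, ∃ E : Set H, E.Finite ∧ ∀ x y, y - x = u → f y - f x ∈ E) :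
    GroupBornologous f := by
  intro F hF
  choose E hE hfE using h
  exact ⟨⋃ u ∈ F, E u, hF.biUnion fun u _ => hE u, fun x y hxy =>
    Set.mem_biUnion hxy (hfE _ x y rfl)⟩

theorem GroupBornologous.comp {g : H → K} {f : G → H} (hg : GroupBornologous g)
    (hf : GroupBornologous f) : GroupBornologous (g ∘ f) := by
  intro F hF
  obtain ⟨E, hE, h⟩ := hf F hF
  obtain ⟨E', hE', h'⟩ := hg E hE
  exact ⟨E', hE', fun x y hxy => h' _ _ (h _ _ hxy)⟩

theorem GroupBornologous.prodMap {f : G → H} {g : K → L} (hf : GroupBornologous f)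
    (hg : GroupBornologous g) : GroupBornologous (Prod.map f g) := by
  intro F hF
  obtain ⟨E, hE, h⟩ := hf _ (hF.image Prod.fst)
  obtain ⟨E', hE', h'⟩ := hg _ (hF.image Prod.snd)
  exact ⟨E ×ˢ E', hE.prod hE', fun x y hxy =>
    ⟨h _ _ ⟨_, hxy, rfl⟩, h' _ _ ⟨_, hxy, rfl⟩⟩⟩

theorem groupBornologous_id : GroupBornologous (id : G → G) :=
  fun F hF => ⟨F, hF, fun _ _ h => h⟩

theorem GroupCoarselyEquivalent.refl (G : Type*) [AddCommGroup G] : GroupCoarselyEquivalent G G :=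
  ⟨id, id, groupBornologous_id, groupBornologous_id, ⟨{0}, Set.finite_singleton 0, by simp⟩,
    ⟨{0}, Set.finite_singleton 0, by simp⟩⟩

theorem GroupCoarselyEquivalent.symm (h : GroupCoarselyEquivalent G H) :
    GroupCoarselyEquivalent H G := by
  obtain ⟨f, g, hf, hg, h1, h2⟩ := h
  exact ⟨g, f, hg, hf, h2, h1⟩

theorem GroupCoarselyEquivalent.trans (h : GroupCoarselyEquivalent G H)
    (h' : GroupCoarselyEquivalent H K) : GroupCoarselyEquivalent G K := by
  obtain ⟨f, g, hf, hg, ⟨F, hF, h1⟩, ⟨E, hE, h2⟩⟩ := h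
  obtain ⟨f', g', hf', hg', ⟨F', hF', h1'⟩, ⟨E', hE', h2'⟩⟩ := h'
  obtain ⟨A, hA, hgA⟩ := hg F' hF'
  obtain ⟨B, hB, hfB⟩ := hf' E hE
  refine ⟨f' ∘ f, g ∘ g', hf'.comp hf, hg.comp hg',
    ⟨Set.image2 (· + ·) A F, hA.image2 _ hF, fun x => ?_⟩,
    ⟨Set.image2 (· + ·) B E', hB.image2 _ hE', fun z => ?_⟩⟩
  · exact ⟨_, hgA _ _ (h1' (f x)), _, h1 x, by simp⟩
  · exact ⟨_, hfB _ _ (h2 (g' z)), _, h2' z, by simp⟩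

theorem GroupCoarselyEquivalent.prod (h : GroupCoarselyEquivalent G H)
    (h' : GroupCoarselyEquivalent K L) : GroupCoarselyEquivalent (G × K) (H × L) := by
  obtain ⟨f, g, hf, hg, ⟨F, hF, h1⟩, ⟨E, hE, h2⟩⟩ := h
  obtain ⟨f', g', hf', hg', ⟨F', hF', h1'⟩, ⟨E', hE', h2'⟩⟩ := h'
  exact ⟨Prod.map f f', Prod.map g g', hf.prodMap hf', hg.prodMap hg',
    ⟨F ×ˢ F', hF.prod hF', fun x => ⟨h1 _, h1' _⟩⟩,
    ⟨E ×ˢ E', hE.prod hE', fun x => ⟨h2 _, h2' _⟩⟩⟩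

theorem groupCoarselyEquivalent_prod_finite (G Q : Type*) [AddCommGroup G] [AddCommGroup Q]
    [Finite Q] : GroupCoarselyEquivalent (G × Q) G := by
  refine ⟨Prod.fst, fun x => (x, 0), ?_, ?_, ⟨{0} ×ˢ Set.univ,
    (Set.finite_singleton _).prod Set.finite_univ, by simp⟩, ⟨{0}, Set.finite_singleton 0, by simp⟩⟩
  · exact fun F hF => ⟨_, hF.image Prod.fst, fun x y hxy => ⟨_, hxy, rfl⟩⟩
  · exact fun F hF => ⟨F ×ˢ {0}, hF.prod (Set.finite_singleton 0), fun x y hxy => by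
      simpa using hxy⟩

theorem dist_eq_dist_zero_sub [MetricSpace G] (hinv : ∀ a x y : G, dist (a + x) (a + y) = dist x y)
    (x y : G) : dist x y = dist 0 (y - x) := by
  have := hinv x 0 (y - x)
  simpa using this

theorem GroupBornologous.bornologous [MetricSpace G] [MetricSpace H] [Countable G] [ProperSpace G]
    (hG : ∀ a x y : G, dist (a + x) (a + y) = dist x y)
    (hH : ∀ a x y : H, dist (a + x) (a + y) = dist x y) {f : G → H} (hf : GroupBornologous f) :
    Bornologous f := by
  intro δ
  obtain ⟨E, hE, h⟩ := hf _ (finite_closedBall_of_countable hG 0 δ)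
  obtain ⟨R, hR⟩ := hE.isBounded.subset_closedBall 0
  refine ⟨R, fun x y hxy => ?_⟩
  rw [dist_eq_dist_zero_sub hG, dist_comm] at hxy
  rw [dist_eq_dist_zero_sub hH, dist_comm]
  exact hR (h x y hxy)

theorem GroupCoarselyEquivalent.coarselyEquivalent [MetricSpace G] [MetricSpace H] [Countable G]
    [Countable H] [ProperSpace G] [ProperSpace H]
    (hG : ∀ a x y : G, dist (a + x) (a + y) = dist x y)
    (hH : ∀ a x y : H, dist (a + x) (a + y) = dist x y) (h : GroupCoarselyEquivalent G H) :
    CoarselyEquivalent G H := by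
  obtain ⟨f, g, hf, hg, ⟨F, hF, h1⟩, ⟨E, hE, h2⟩⟩ := h
  obtain ⟨R, hR⟩ := hF.isBounded.subset_closedBall 0
  obtain ⟨S, hS⟩ := hE.isBounded.subset_closedBall 0
  refine ⟨f, g, hf.bornologous hG hH, hg.bornologous hH hG, max R S, fun x => ?_, fun y => ?_⟩
  · rw [dist_comm, dist_eq_dist_zero_sub hG, dist_comm]
    exact le_trans (hR (h1 x)) (le_max_left _ _)
  · rw [dist_comm, dist_eq_dist_zero_sub hH, dist_comm]
    exact le_trans (hS (h2 y)) (le_max_right _ _)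

theorem largeScaleConnected_iff_fg [MetricSpace G] [Countable G] [ProperSpace G]
    (hG : ∀ a x y : G, dist (a + x) (a + y) = dist x y) :
    LargeScaleConnected G ↔ AddGroup.FG G := by
  constructor
  · rintro ⟨ε, -, h⟩
    rw [epsConnected_iff_reflTransGen] at h
    refine AddGroup.fg_iff.2 ⟨Metric.closedBall 0 ε, ?_, finite_closedBall_of_countable hG 0 ε⟩
    refine (AddSubgroup.eq_top_iff' _).2 fun x => ?_
    induction h 0 x with
    | refl => exact zero_mem _
    | @tail b c _ hbc ih =>
      have : c - b ∈ AddSubgroup.closure (Metric.closedBall (0 : G) ε) := by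
        refine AddSubgroup.subset_closure ?_
        rw [Metric.mem_closedBall, dist_comm, ← dist_eq_dist_zero_sub hG]
        exact hbc
      simpa using add_mem this ih
  · intro h
    obtain ⟨S, hS, hfin⟩ := AddGroup.fg_iff.1 h
    obtain ⟨R, hR⟩ := hfin.isBounded.subset_closedBall 0
    refine ⟨max 0 R, le_max_left _ _, epsConnected_iff_reflTransGen.2 fun x y => ?_⟩
    have key : ∀ g : G, ∀ x, Relation.ReflTransGen (fun a b : G => dist a b ≤ max 0 R) x (x + g) := by
      intro g
      have hg : g ∈ AddSubgroup.closure S := hS ▸ AddSubgroup.mem_top g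
      induction hg using AddSubgroup.closure_induction with
      | mem s hs =>
        intro x
        refine Relation.ReflTransGen.single ?_
        rw [dist_eq_dist_zero_sub hG, dist_comm]
        simpa using Or.inr (hR hs)
      | zero => intro x; simpa using Relation.ReflTransGen.refl
      | add a b _ _ ha hb => intro x; rw [← add_assoc]; exact (ha x).trans (hb _)
      | neg a _ ha =>
        intro x
        have h1 := ha (x + -a)
        rw [neg_add_cancel_right] at h1
        have : Std.Symm (fun a b : G => dist a b ≤ max 0 R) := ⟨fun a b hab => by rwa [dist_comm]⟩
        exact Relation.ReflTransGen.stdSymm.symm _ _ h1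
    simpa using key (y - x) x

end

/-! ### Splitting off a free subgroup with torsion quotient. -/

section

variable {ι G : Type*} [AddCommGroup G]

/-- If `φ` embeds a free abelian group in `G` with torsion cokernel, then `φ⁻¹` extends to a
homomorphism on `G` with rational values. -/
theorem exists_rational_coordinates (φ : (ι →₀ ℤ) →+ G) (hφ : Function.Injective φ)
    (htor : ∀ g, ∃ m : ℕ, m ≠ 0 ∧ m • g ∈ φ.range) :
    ∃ c : G →+ (ι →₀ ℚ), ∀ a i, c (φ a) i = a i := by
  choose m hm a ha using htor
  have key : ∀ (g : G) (k : ℕ) (b : ι →₀ ℤ), k • g = φ b → ∀ i, (k : ℚ) * a g i = m g * b i := by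
    intro g k b hb i
    have : φ (k • a g) = φ (m g • b) := by
      rw [map_nsmul, map_nsmul, ha, ← hb, smul_comm]
    have h := DFunLike.congr_fun (hφ this) i
    simp only [Finsupp.smul_apply, nsmul_eq_mul] at h
    exact_mod_cast h
  have hm' : ∀ g, (m g : ℚ) ≠ 0 := fun g => by exact_mod_cast hm g
  -- The coordinates of `g` are `a g / m g`. By `key` they do not depend on the chosen multiple,
  -- which gives additivity.
  refine ⟨AddMonoidHom.mk' (fun g => (m g : ℚ)⁻¹ • (a g).mapRange (Int.cast : ℤ → ℚ) Int.cast_zero)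
    fun g h => ?_, fun b i => ?_⟩
  · ext i
    have := key (g + h) (m g * m h) (m h • a g + m g • a h) (by
      rw [smul_add, map_add, map_nsmul, map_nsmul, ha, ha, smul_smul, smul_smul, mul_comm]) i
    simp only [Finsupp.add_apply, Finsupp.smul_apply, nsmul_eq_mul] at this
    push_cast at this
    have h1 := hm' g
    have h2 := hm' h
    have h3 := hm' (g + h)
    simp only [Finsupp.add_apply, Finsupp.smul_apply, Finsupp.mapRange_apply, smul_eq_mul]
    field_simp
    linarith
  · have := key (φ b) 1 b (by simp) i
    have h1 := hm' (φ b)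
    simp only [AddMonoidHom.mk'_apply, Finsupp.smul_apply, Finsupp.mapRange_apply, smul_eq_mul]
    field_simp
    simpa using this

/-- The coordinatewise integral part of a finitely supported rational vector. -/
noncomputable def finsuppFloor (x : ι →₀ ℚ) : ι →₀ ℤ := x.mapRange Int.floor Int.floor_zero

/-- The coordinatewise rounding up of a finitely supported rational vector. -/
noncomputable def finsuppCeil (x : ι →₀ ℚ) : ι →₀ ℤ := x.mapRange Int.ceil Int.ceil_zero

@[simp] theorem finsuppFloor_apply (x : ι →₀ ℚ) (i : ι) : finsuppFloor x i = ⌊x i⌋ := by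
  simp [finsuppFloor]

@[simp] theorem finsuppCeil_apply (x : ι →₀ ℚ) (i : ι) : finsuppCeil x i = ⌈x i⌉ := by
  simp [finsuppCeil]

/-- A group is coarsely the product of a free subgroup with torsion quotient and the quotient. -/
theorem groupCoarselyEquivalent_prod_quotient (φ : (ι →₀ ℤ) →+ G) (hφ : Function.Injective φ)
    (htor : ∀ g, ∃ m : ℕ, m ≠ 0 ∧ m • g ∈ φ.range) :
    GroupCoarselyEquivalent G ((ι →₀ ℤ) × (G ⧸ φ.range)) := by
  classical
  obtain ⟨c, hc⟩ := exists_rational_coordinates φ hφ htor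
  obtain ⟨lift, hlift⟩ : ∃ lift : G ⧸ φ.range → G, ∀ t, (lift t : G ⧸ φ.range) = t :=
    ⟨Quotient.out, fun t => QuotientAddGroup.out_eq' t⟩
  have hmk : ∀ x y : G, (x : G ⧸ φ.range) = y → ∃ a, y = x + φ a := by
    intro x y h
    obtain ⟨a, ha⟩ := QuotientAddGroup.eq.1 h
    exact ⟨a, by rw [ha]; abel⟩
  -- Subtracting the integral part moves the coordinates of the representative into `[0, 1)`. This
  -- makes the two maps below mutually inverse.
  set s : G ⧸ φ.range → G := fun t => lift t - φ (finsuppFloor (c (lift t))) with hs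
  have hst : ∀ t, (s t : G ⧸ φ.range) = t := fun t => by
    have : ((φ (finsuppFloor (c (lift t))) : G) : G ⧸ φ.range) = 0 :=
      (QuotientAddGroup.eq_zero_iff _).2 ⟨_, rfl⟩
    rw [hs, QuotientAddGroup.mk_sub, this, sub_zero, hlift]
  have hcs : ∀ t i, 0 ≤ c (s t) i ∧ c (s t) i < 1 := fun t i => by
    have : c (s t) i = Int.fract (c (lift t) i) := by
      simp [hs, hc, -Int.self_sub_floor, Int.fract.eq_1]
    rw [this]
    exact ⟨Int.fract_nonneg _, Int.fract_lt_one _⟩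
  have hφ0 : ∀ a, ((φ a : G) : G ⧸ φ.range) = 0 := fun a =>
    (QuotientAddGroup.eq_zero_iff _).2 ⟨_, rfl⟩
  refine ⟨fun g => (finsuppFloor (c g), g), fun p => φ p.1 + s p.2, ?_, ?_,
    ⟨{0}, Set.finite_singleton 0, fun x => ?_⟩, ⟨{0}, Set.finite_singleton 0, fun p => ?_⟩⟩
  · refine groupBornologous_of_singleton fun u => ⟨Set.Icc (finsuppFloor (c u)) (finsuppCeil (c u))
      ×ˢ {(u : G ⧸ φ.range)}, (Set.finite_Icc _ _).prod (Set.finite_singleton _), fun x y hxy => ?_⟩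
    obtain rfl : y = x + u := by rw [← hxy]; abel
    refine ⟨⟨fun i => ?_, fun i => ?_⟩, by simp⟩
    · have := Int.le_floor_add (c x i) (c u i)
      change _ ≤ finsuppFloor (c (x + u)) i - finsuppFloor (c x) i
      simp only [finsuppFloor_apply, map_add, Finsupp.add_apply]
      omega
    · change finsuppFloor (c (x + u)) i - finsuppFloor (c x) i ≤ _
      simp only [finsuppFloor_apply, finsuppCeil_apply, map_add, Finsupp.add_apply]
      have h1 : ⌊c x i + c u i⌋ ≤ ⌊c x i + ⌈c u i⌉⌋ :=
        Int.floor_le_floor (by linarith [Int.le_ceil (c u i)])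
      rw [Int.floor_add_intCast] at h1
      omega
  · refine groupBornologous_of_singleton fun p => ?_
    obtain ⟨b, w⟩ := p
    -- The error `α` differs from `-c (lift w)` by less than 1 in each coordinate, so it vanishes
    -- wherever `c (lift w)` does. Hence it lies in a finite box even when `ι` is infinite.
    refine ⟨(fun a => φ b + (lift w + φ a)) '' Set.Icc (finsuppFloor (-c (lift w)))
      (finsuppCeil (-c (lift w))), (Set.finite_Icc _ _).image _, ?_⟩
    rintro ⟨a, t⟩ ⟨a', t'⟩ h
    obtain ⟨h1, h2⟩ := Prod.mk.inj h
    obtain ⟨α, hα⟩ := hmk (lift w) (s t' - s t) (by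
      rw [hlift, QuotientAddGroup.mk_sub, hst, hst, h2])
    refine ⟨α, ?_, ?_⟩
    · have hi : ∀ i, c (s t') i - c (s t) i = c (lift w) i + α i := fun i => by
        have := DFunLike.congr_fun (congrArg c hα) i
        simpa [hc] using this
      refine ⟨fun i => ?_, fun i => ?_⟩
      · rw [finsuppFloor_apply, ← Int.lt_add_one_iff, Int.floor_lt]
        have := hi i
        have := hcs t i
        have := hcs t' i
        push_cast
        rw [Pi.neg_apply]
        linarith
      · rw [finsuppCeil_apply, ← Int.sub_one_lt_iff, Int.lt_ceil]
        have := hi i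
        have := hcs t i
        have := hcs t' i
        push_cast
        rw [Pi.neg_apply]
        linarith
    · have : φ a' + s t' - (φ a + s t) = φ (a' - a) + (s t' - s t) := by rw [map_sub]; abel
      simp only [this, hα]
      rw [show b = a' - a from h1.symm]
  · obtain ⟨α, hα⟩ := hmk (φ (finsuppFloor (c x)) + s x) x (by
      rw [QuotientAddGroup.mk_add, hst, hφ0, zero_add])
    have : α = 0 := by
      ext i
      have h := DFunLike.congr_fun (congrArg c hα) i
      simp only [map_add, Finsupp.add_apply, hc, finsuppFloor_apply] at h
      have h1 := hcs x i
      have h2 := Int.floor_le (c x i)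
      have h3 := Int.lt_floor_add_one (c x i)
      have h4 : (-1 : ℚ) < α i := by linarith
      have h5 : (α i : ℚ) < 1 := by linarith
      have h4' : (-1 : ℤ) < α i := by exact_mod_cast h4
      have h5' : α i < 1 := by exact_mod_cast h5
      simp only [Finsupp.zero_apply]
      omega
    rw [this, map_zero, add_zero] at hα
    simp [← hα]
  · obtain ⟨a, t⟩ := p
    have h1 : finsuppFloor (c (φ a + s t)) = a := by
      ext i
      simp only [map_add, finsuppFloor_apply, Finsupp.add_apply, hc, Int.floor_intCast_add]
      rw [Int.floor_eq_zero_iff.2 (hcs t i), add_zero]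
    have h2 : ((φ a + s t : G) : G ⧸ φ.range) = t := by
      rw [QuotientAddGroup.mk_add, hφ0, hst, zero_add]
    simp only [h1, h2, sub_self, Set.mem_singleton_iff]

end

/-! ### Matching two systems of nested intervals in the natural numbers. -/

theorem exists_floor_index (e : ℕ → ℕ) (h0 : e 0 = 0) (hlt : ∀ p, e p < e (p + 1)) (q : ℕ) :
    ∃ p, e p ≤ q ∧ q < e (p + 1) := by
  have hmono : StrictMono e := strictMono_nat_of_lt_succ hlt
  refine ⟨Nat.findGreatest (fun p => e p ≤ q) q, ?_, ?_⟩
  · exact Nat.findGreatest_spec (P := fun p => e p ≤ q) (Nat.zero_le q) (by simp [h0])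
  · by_contra hcon
    rw [not_lt] at hcon
    exact absurd (Nat.le_findGreatest (P := fun p => e p ≤ q) ((hmono.id_le _).trans hcon) hcon)
      (Nat.not_succ_le_self _)

/-- A sequence of boundaries of intervals with between `lo'` and `hi'` elements can be mapped
by another sequence of that kind onto the multiples of `r`. -/
theorem exists_refined_boundaries {e' : ℕ → ℕ} {lo' hi' lo hi r : ℕ} (h0 : e' 0 = 0)
    (hd : ∀ p, e' p + lo' ≤ e' (p + 1) ∧ e' (p + 1) ≤ e' p + hi') (hlo' : 1 ≤ lo')
    (h1 : hi' * lo ≤ r) (h2 : r ≤ lo' * hi) :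
    ∃ e : ℕ → ℕ, e 0 = 0 ∧ (∀ p, e p + lo ≤ e (p + 1) ∧ e (p + 1) ≤ e p + hi) ∧
      ∀ p, e (e' p) = r * p := by
  have hlt : ∀ p, e' p < e' (p + 1) := fun p => by have := hd p; omega
  have hmono : StrictMono e' := strictMono_nat_of_lt_succ hlt
  choose P hP1 hP2 using exists_floor_index e' h0 hlt
  have huniq : ∀ p q, e' p ≤ q → q < e' (p + 1) → P q = p := by
    intro p q hp hq
    have h3 := hmono.lt_iff_lt.1 ((hP1 q).trans_lt hq)
    have h4 := hmono.lt_iff_lt.1 (hp.trans_lt (hP2 q))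
    omega
  -- Each interval from `r * p` to `r * (p + 1)` is cut as evenly as possible into `s` pieces, where
  -- `lo' ≤ s ≤ hi'`. Then `lo * s ≤ r ≤ hi * s` bounds the lengths of the pieces.
  set e : ℕ → ℕ := fun q => r * P q + r * (q - e' (P q)) / (e' (P q + 1) - e' (P q)) with he
  have hstart : ∀ p, e (e' p) = r * p := fun p => by
    simp [he, huniq p (e' p) le_rfl (hlt p)]
  have hform : ∀ p i, i ≤ e' (p + 1) - e' p →
      e (e' p + i) = r * p + r * i / (e' (p + 1) - e' p) := by
    intro p i hi'
    rcases Nat.lt_or_eq_of_le hi' with h | h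
    · have := huniq p (e' p + i) (by omega) (by omega)
      simp [he, this]
    · have h3 := hlt p
      rw [h, Nat.add_sub_cancel' h3.le, hstart, Nat.mul_div_cancel _ (by omega)]
      ring
  refine ⟨e, by simpa [h0] using hstart 0, fun q => ?_, hstart⟩
  have hq1 := hP1 q
  have hq2 := hP2 q
  have hdq := hd (P q)
  set s := e' (P q + 1) - e' (P q) with hs
  have hs0 : 0 < s := by omega
  have e1 := hform (P q) (q - e' (P q)) (by omega)
  have e2 := hform (P q) (q - e' (P q) + 1) (by omega)
  rw [show e' (P q) + (q - e' (P q)) = q by omega] at e1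
  rw [show e' (P q) + (q - e' (P q) + 1) = q + 1 by omega] at e2
  rw [e1, e2, ← hs]
  set i := q - e' (P q)
  have hls : lo * s ≤ r := by
    refine le_trans ?_ h1
    rw [mul_comm]
    exact Nat.mul_le_mul_right _ (by omega)
  have hhs : r ≤ hi * s := by
    refine h2.trans ?_
    rw [mul_comm]
    exact Nat.mul_le_mul_left _ (by omega)
  constructor
  · rw [add_assoc, ← Nat.add_mul_div_right _ _ hs0]
    refine Nat.add_le_add_left (Nat.div_le_div_right ?_) _
    rw [mul_add, mul_one]
    omega
  · rw [add_assoc, ← Nat.add_mul_div_right _ _ hs0]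
    refine Nat.add_le_add_left (Nat.div_le_div_right ?_) _
    rw [mul_add, mul_one]
    omega

/-- The recursion runs downwards from level `J`, where equal intervals are used. Each lower level is
a refinement given by `exists_refined_boundaries`. -/
theorem exists_interleaving_below (J : ℕ) : ∀ {lo hi r : ℕ → ℕ} (_ : ∀ j, 1 ≤ lo j)
    (_ : ∀ j, lo j ≤ hi j)
    (_ : ∀ j, hi (j + 1) * lo j ≤ r j) (_ : ∀ j, r j ≤ lo (j + 1) * hi j),
    ∃ e : ℕ → ℕ → ℕ, (∀ j ≤ J, e j 0 = 0) ∧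
      (∀ j ≤ J, ∀ p, e j p + lo j ≤ e j (p + 1) ∧ e j (p + 1) ≤ e j p + hi j) ∧
      ∀ j < J, ∀ p, e j (e (j + 1) p) = r j * p := by
  induction J with
  | zero =>
    intro lo hi r h1 h2 _ _
    refine ⟨fun j p => lo j * p, by simp, fun j _ p => ?_, by simp⟩
    have := h2 j
    simp only [mul_add, mul_one]
    omega
  | succ J ih =>
    intro lo hi r h1 h2 h3 h4
    obtain ⟨e, e0, e1, e2⟩ := ih (lo := fun j => lo (j + 1)) (hi := fun j => hi (j + 1))
      (r := fun j => r (j + 1)) (fun j => h1 _) (fun j => h2 _) (fun j => h3 _) (fun j => h4 _)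
    obtain ⟨a, a0, a1, a2⟩ := exists_refined_boundaries (e0 0 (Nat.zero_le _))
      (e1 0 (Nat.zero_le _)) (h1 1) (h3 0) (h4 0)
    refine ⟨fun j => Nat.casesOn j a e, fun j hj => ?_, fun j hj => ?_, fun j hj => ?_⟩
    · cases j with
      | zero => exact a0
      | succ j => exact e0 j (by omega)
    · cases j with
      | zero => exact a1
      | succ j => exact e1 j (by omega)
    · cases j with
      | zero => exact a2
      | succ j => exact e2 j (by omega)

theorem Ultrafilter.exists_eventually_eq_of_bounded {α : Type*} (U : Ultrafilter α) (f : α → ℕ)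
    (B : ℕ) (h : ∀ᶠ a in U, f a ≤ B) : ∃ v, ∀ᶠ a in U, f a = v := by
  induction B with
  | zero => exact ⟨0, h.mono fun a ha => Nat.le_zero.1 ha⟩
  | succ B ih =>
    have : ∀ᶠ a in U, f a ≤ B ∨ f a = B + 1 := h.mono fun a ha => by omega
    rcases Ultrafilter.eventually_or.1 this with h | h
    · exact ih h
    · exact ⟨_, h⟩

/-- Compactness: the finite solutions satisfy `E J j p ≤ hi j * p` uniformly in `J`, so each value
stabilises along an ultrafilter, and every required relation involves only finitely many values. -/
theorem exists_interleaving {lo hi r : ℕ → ℕ} (h1 : ∀ j, 1 ≤ lo j) (h2 : ∀ j, lo j ≤ hi j)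
    (h3 : ∀ j, hi (j + 1) * lo j ≤ r j) (h4 : ∀ j, r j ≤ lo (j + 1) * hi j) :
    ∃ e : ℕ → ℕ → ℕ, (∀ j, e j 0 = 0) ∧ (∀ j p, e j p < e j (p + 1)) ∧
      ∀ j p, e j (e (j + 1) p) = r j * p := by
  choose E E0 E1 E2 using fun J => exists_interleaving_below J h1 h2 h3 h4
  let U : Ultrafilter ℕ := Filter.hyperfilter ℕ
  have hU : ∀ j, ∀ᶠ J in (U : Filter ℕ), j < J := fun j =>
    Nat.hyperfilter_le_atTop (Filter.eventually_gt_atTop j)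
  have hbound : ∀ j p, ∀ᶠ J in (U : Filter ℕ), E J j p ≤ hi j * p := by
    intro j p
    filter_upwards [hU j] with J hJ
    induction p with
    | zero => simp [E0 J j hJ.le]
    | succ p ih =>
      have := (E1 J j hJ.le p).2
      rw [mul_add, mul_one]
      omega
  choose e he using fun j p => U.exists_eventually_eq_of_bounded _ _ (hbound j p)
  refine ⟨e, fun j => ?_, fun j p => ?_, fun j p => ?_⟩
  · obtain ⟨J, h, h'⟩ := ((he j 0).and (hU j)).exists
    rw [← h, E0 J j h'.le]
  · obtain ⟨J, ha, hb, hc⟩ := ((he j p).and ((he j (p + 1)).and (hU j))).exists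
    have := (E1 J j hc.le p).1
    have := h1 j
    omega
  · obtain ⟨J, ha, hb, hc⟩ := ((he (j + 1) p).and ((he j (e (j + 1) p)).and (hU j))).exists
    rw [← hb, ← ha, E2 J j hc]

/-- `F` alternates between the orders of the subgroups in two filtrations. Skipping far enough along
the filtration makes the ratio `r j` so large that the window from `lo` to `hi` never closes. -/
theorem exists_interleaving_data (F : ℕ → ℕ → ℕ) (hF : ∀ j, F (j + 2) = F j)
    (hpos : ∀ j k, 0 < F j k) (hdvd : ∀ j k l, k ≤ l → F j k ∣ F j l)
    (hunb : ∀ j B, ∃ k, B ≤ F j k) :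
    ∃ a lo hi r : ℕ → ℕ, a 0 = 0 ∧ a 1 = 0 ∧ (∀ j, a j < a (j + 2)) ∧
      (∀ j, F (j + 2) (a (j + 2)) = F j (a j) * r j) ∧ (∀ j, 1 ≤ lo j) ∧ (∀ j, lo j ≤ hi j) ∧
      (∀ j, hi (j + 1) * lo j ≤ r j) ∧ ∀ j, r j ≤ lo (j + 1) * hi j := by
  have step : ∀ (j : ℕ) (s : {p : (ℕ × ℕ) × ℕ × ℕ // 1 ≤ p.2.1 ∧ p.2.1 < p.2.2}),
      ∃ t : {p : (ℕ × ℕ) × ℕ × ℕ // 1 ≤ p.2.1 ∧ p.2.1 < p.2.2},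
      t.1.1.1 = s.1.1.2 ∧ s.1.1.1 < t.1.1.2 ∧ ∃ r, F j t.1.1.2 = F j s.1.1.1 * r ∧
        t.1.2.2 * s.1.2.1 ≤ r ∧ r ≤ t.1.2.1 * s.1.2.2 := by
    rintro j ⟨⟨⟨a, b⟩, lo, hi⟩, h1, h2⟩
    simp only at h1 h2
    obtain ⟨k₀, hk₀⟩ := hunb j (2 * lo * hi * F j a)
    set k := max k₀ (a + 1)
    obtain ⟨r, hr⟩ := hdvd j a k (le_trans (Nat.le_succ a) (le_max_right _ _))
    have hk : F j k₀ ≤ F j k := Nat.le_of_dvd (hpos j k) (hdvd j _ _ (le_max_left _ _))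
    have hr' : 2 * lo * hi ≤ r := by
      refine Nat.le_of_mul_le_mul_left ?_ (hpos j a)
      rw [← hr, mul_comm]
      exact hk₀.trans hk
    have hq : 2 * lo ≤ r / hi := (Nat.le_div_iff_mul_le (by omega)).2 hr'
    have hq' : r / hi * hi ≤ r := Nat.div_mul_le_self _ _
    -- The widest window that the two inequalities allow, apart from rounding. It is nonempty
    -- because `r / hi ≥ 2 * lo` and `hi ≥ lo + 1` give `(r / hi + 2) * lo ≤ r`.
    refine ⟨⟨⟨⟨b, k⟩, r / hi + 1, r / lo⟩, by simp, ?_⟩, rfl, ?_, r, hr,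
      Nat.div_mul_le_self _ _, ?_⟩
    · refine (Nat.le_div_iff_mul_le (by omega)).2 ?_
      simp only [Nat.succ_eq_add_one]
      obtain ⟨d, rfl⟩ : ∃ d, hi = lo + 1 + d := ⟨hi - (lo + 1), by omega⟩
      nlinarith
    · exact lt_of_lt_of_le (Nat.lt_succ_self a) (le_max_right _ _)
    · exact (Nat.lt_div_mul_add (by omega : 0 < hi)).le.trans (by simp only; rw [add_mul, one_mul])
  choose nxt hn1 hn2 r hr1 hr2 hr3 using step
  let s : ℕ → {p : (ℕ × ℕ) × ℕ × ℕ // 1 ≤ p.2.1 ∧ p.2.1 < p.2.2} :=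
    fun j => Nat.rec ⟨((0, 0), 1, 2), by simp⟩ (fun j s => nxt j s) j
  have hs : ∀ j, s (j + 1) = nxt j (s j) := fun j => rfl
  have ha : ∀ j, (s (j + 2)).1.1.1 = (s (j + 1)).1.1.2 := fun j => by rw [hs (j + 1), hn1]
  refine ⟨fun j => (s j).1.1.1, fun j => (s j).1.2.1, fun j => (s j).1.2.2, fun j => r j (s j),
    rfl, ?_, fun j => ?_, fun j => ?_, fun j => (s j).2.1, fun j => (s j).2.2.le, fun j => ?_,
    fun j => ?_⟩
  · exact hn1 0 (s 0)
  · simp only [ha]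
    exact hn2 j (s j)
  · simp only [ha, hF]
    exact hr1 j (s j)
  · exact hr2 j (s j)
  · exact hr3 j (s j)

/-- The two divisibility conclusions say that `e` takes coarse boundaries of the system `M'` to
boundaries of `M`, and that all sufficiently coarse boundaries of `M` come from boundaries of `M'`.
-/
theorem exists_block_interleaving {M M' : ℕ → ℕ} (hM0 : M 0 = 1) (hM0' : M' 0 = 1)
    (hpos : ∀ k, 0 < M k) (hpos' : ∀ k, 0 < M' k) (hdvd : ∀ k l, k ≤ l → M k ∣ M l)
    (hdvd' : ∀ k l, k ≤ l → M' k ∣ M' l) (hunb : ∀ B, ∃ k, B ≤ M k) (hunb' : ∀ B, ∃ k, B ≤ M' k) :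
    ∃ e : ℕ → ℕ, e 0 = 0 ∧ (∀ p, e p < e (p + 1)) ∧ (∀ k, ∃ l, ∀ p, M k ∣ e (M' l * p)) ∧
      ∀ k, ∃ l, ∀ p, ∃ q, e (M' k * q) = M l * p := by
  let F : ℕ → ℕ → ℕ := fun j => if Even j then M else M'
  have hFe : ∀ k, F (2 * k) = M := fun k => by simp [F]
  have hFo : ∀ k, F (2 * k + 1) = M' := fun k => by simp [F]
  obtain ⟨a, lo, hi, r, a0, a1, ha, hN, h1, h2, h3, h4⟩ := exists_interleaving_data F
    (fun j => by simp [F, Nat.even_add]) (fun j k => by dsimp [F]; split_ifs <;> simp [hpos, hpos'])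
    (fun j k l hkl => by dsimp [F]; split_ifs; exacts [hdvd k l hkl, hdvd' k l hkl])
    (fun j B => by dsimp [F]; split_ifs; exacts [hunb B, hunb' B])
  obtain ⟨e, e0, e1, e2⟩ := exists_interleaving h1 h2 h3 h4
  have hNe : ∀ k, M (a (2 * k + 2)) = M (a (2 * k)) * r (2 * k) := fun k => by
    have := hN (2 * k)
    rwa [hFe k, show 2 * k + 2 = 2 * (k + 1) by ring, hFe (k + 1)] at this
  have hNo : ∀ k, M' (a (2 * k + 3)) = M' (a (2 * k + 1)) * r (2 * k + 1) := fun k => by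
    have := hN (2 * k + 1)
    rwa [hFo k, show 2 * k + 1 + 2 = 2 * (k + 1) + 1 by ring, hFo (k + 1)] at this
  have hge : ∀ k, k ≤ a (2 * k) ∧ k ≤ a (2 * k + 1) := by
    intro k
    induction k with
    | zero => simp
    | succ k ih =>
      have u := ha (2 * k)
      have v := ha (2 * k + 1)
      rw [show 2 * (k + 1) = 2 * k + 2 by ring, show 2 * k + 2 + 1 = 2 * k + 1 + 2 by ring]
      omega
  -- Telescoping two levels at a time: `e j ∘ e (j + 1)` is multiplication by `r j`, and the
  -- products of the `r j` over even and odd `j` are the orders in the two filtrations.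
  have key : ∀ k p, e 0 (M' (a (2 * k + 1)) * p) = M (a (2 * k)) * e (2 * k) p := by
    intro k
    induction k with
    | zero => intro p; simp [a0, a1, hM0, hM0']
    | succ k ih =>
      intro p
      rw [show 2 * (k + 1) = 2 * k + 2 by ring, show 2 * k + 2 + 1 = 2 * k + 3 by ring, hNo, hNe,
        mul_assoc, ih, ← e2 (2 * k + 1), e2 (2 * k), mul_assoc]
  refine ⟨e 0, e0 0, e1 0, fun k => ⟨a (2 * k + 1), fun p => ?_⟩,
    fun k => ⟨a (2 * k + 2), fun p => ?_⟩⟩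
  · rw [key]
    exact Dvd.dvd.mul_right (hdvd _ _ (hge k).1) _
  · obtain ⟨c, hc⟩ := hdvd' _ _ (hge k).2
    refine ⟨c * e (2 * k + 1) p, ?_⟩
    rw [← mul_assoc, ← hc, key, e2, hNe, mul_assoc]

/-! ### Infinite countable torsion groups are all coarsely equivalent. -/

theorem exists_mul_between_of_div_lt {M a b : ℕ} (hM : 0 < M) (h : a / M < b / M) :
    ∃ p, a < M * p ∧ M * p ≤ b :=
  ⟨b / M, by rw [mul_comm]; exact (Nat.div_lt_iff_lt_mul hM).1 h, Nat.mul_div_le b M⟩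

theorem div_lt_of_lt_mul_le {M a b p : ℕ} (hM : 0 < M) (h : a < M * p) (h' : M * p ≤ b) :
    a / M < b / M :=
  lt_of_lt_of_le ((Nat.div_lt_iff_lt_mul hM).2 (by rwa [mul_comm]))
    ((Nat.le_div_iff_mul_le hM).2 (by rwa [mul_comm]))

theorem exists_finite_filtration (T : Type*) [AddCommGroup T] [Countable T] [Infinite T]
    (hT : IsAddTorsion T) :
    ∃ S : ℕ → AddSubgroup T, Monotone S ∧ S 0 = ⊥ ∧ (∀ k, Finite (S k)) ∧ (∀ x, ∃ k, x ∈ S k) ∧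
      ∀ B, ∃ k, B ≤ Nat.card (S k) := by
  obtain ⟨t, ht⟩ := exists_surjective_nat T
  set S : ℕ → AddSubgroup T := fun k => AddSubgroup.closure (t '' Set.Iio k) with hS
  have hmono : Monotone S := fun k l hkl =>
    AddSubgroup.closure_mono (Set.image_mono (Set.Iio_subset_Iio hkl))
  have hmem : ∀ x, ∃ k, x ∈ S k := fun x => by
    obtain ⟨i, rfl⟩ := ht x
    exact ⟨i + 1, AddSubgroup.subset_closure ⟨i, Nat.lt_succ_self i, rfl⟩⟩
  have hfin : ∀ k, Finite (S k) := fun k => by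
    have : AddGroup.FG (S k) := by
      rw [AddGroup.fg_iff_addSubgroup_fg]
      exact ⟨((Set.finite_Iio k).image t).toFinset, by simp [hS]⟩
    exact AddCommGroup.finite_of_fg_isAddTorsion _ (hT.addSubgroup _)
  refine ⟨S, hmono, by simp [hS], hfin, hmem, fun B => ?_⟩
  obtain ⟨s, hs⟩ := Infinite.exists_subset_card_eq T B
  choose k hk using hmem
  refine ⟨s.sup k, ?_⟩
  have hsub : (s : Set T) ⊆ S (s.sup k) := fun x hx => hmono (Finset.le_sup hx) (hk x)
  have h := Set.ncard_le_ncard hsub (Set.toFinite (S (s.sup k) : Set T))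
  rw [Set.ncard_coe_finset, hs] at h
  exact h

/-- The digit of `x` numbers its `A`-coset inside its `B`-coset. The coset `A` itself gets 0, so
that in a filtration all but finitely many digits of an element vanish. -/
theorem exists_coset_digit {T : Type*} [AddCommGroup T] {A B : AddSubgroup T} (hAB : A ≤ B)
    [Finite B] :
    ∃ D : T → ℕ, (∀ x, Nat.card A * (D x + 1) ≤ Nat.card B) ∧ (∀ x ∈ A, D x = 0) ∧
      (∀ x y, y - x ∈ A → D x = D y) ∧ ∀ x y, y - x ∈ B → D x = D y → y - x ∈ A := by
  obtain ⟨σ, hσ, hσ0⟩ : ∃ σ : T ⧸ B → T, (∀ x : T, x - σ x ∈ B) ∧ σ 0 = 0 := by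
    classical
    refine ⟨fun t => if t = 0 then 0 else t.out, fun x => ?_, by simp⟩
    dsimp only
    split_ifs with h
    · simpa using (QuotientAddGroup.eq_zero_iff x).1 h
    · have := QuotientAddGroup.eq.1 (QuotientAddGroup.out_eq' (x : T ⧸ B))
      rwa [neg_add_eq_sub] at this
  let Q := B ⧸ A.addSubgroupOf B
  have hcard : Nat.card B = Nat.card Q * Nat.card A := by
    rw [AddSubgroup.card_eq_card_quotient_mul_card_addSubgroup (A.addSubgroupOf B),
      Nat.card_congr (AddSubgroup.addSubgroupOfEquivOfLe hAB).toEquiv]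
  have hQ : 0 < Nat.card Q := Nat.card_pos
  obtain ⟨ι, hι⟩ : ∃ ι : Q ≃ Fin (Nat.card Q), (ι 0 : ℕ) = 0 := by
    let ι := Finite.equivFin Q
    refine ⟨ι.trans (Equiv.swap (ι 0) ⟨0, hQ⟩), by simp⟩
  let q : T → Q := fun x => ((⟨x - σ x, hσ x⟩ : B) : Q)
  have hq : ∀ x y, y - x ∈ B → (q x = q y ↔ y - x ∈ A) := by
    intro x y hxy
    have : (x : T ⧸ B) = y := QuotientAddGroup.eq.2 (by rwa [neg_add_eq_sub])
    have h2 : -(x - σ x) + (y - σ y) = y - x := by rw [this]; abel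
    rw [QuotientAddGroup.eq, AddSubgroup.mem_addSubgroupOf]
    change -(x - σ x) + (y - σ y) ∈ A ↔ _
    rw [h2]
  refine ⟨fun x => ι (q x), fun x => ?_, fun x hx => ?_, fun x y hxy => ?_, fun x y hxy h => ?_⟩
  · rw [hcard, mul_comm]
    exact Nat.mul_le_mul_right _ (ι (q x)).2
  · have h0 : q 0 = q x := (hq 0 x (by simpa using hAB hx)).2 (by simpa using hx)
    have h1 : q 0 = 0 := by
      refine (QuotientAddGroup.eq_zero_iff _).2 ?_
      rw [AddSubgroup.mem_addSubgroupOf]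
      simp [hσ0]
    change (ι (q x) : ℕ) = 0
    rw [← h0, h1, hι]
  · simp only [(hq x y (hAB hxy)).2 hxy]
  · exact (hq x y hxy).1 (ι.injective (Fin.ext h))

/-- An infinite countable torsion abelian group can be enumerated so that the cosets of the members
of a filtration by finite subgroups are enumerated by the intervals into which the multiples of
their orders divide the natural numbers. -/
theorem exists_block_enumeration {T : Type*} [AddCommGroup T] {S : ℕ → AddSubgroup T}
    (hmono : Monotone S) (h0 : S 0 = ⊥) (hfin : ∀ k, Finite (S k)) (hmem : ∀ x, ∃ k, x ∈ S k)
    (hunb : ∀ B, ∃ k, B ≤ Nat.card (S k)) :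
    ∃ β : T ≃ ℕ, ∀ k x y, y - x ∈ S k ↔ β x / Nat.card (S k) = β y / Nat.card (S k) := by
  choose D hD1 hD2 hD3 hD4 using fun k => exists_coset_digit (hmono (Nat.le_succ k))
  set M : ℕ → ℕ := fun k => Nat.card (S k) with hM
  have hpos : ∀ k, 0 < M k := fun k => Nat.card_pos
  have hdvd : ∀ k l, k ≤ l → M k ∣ M l := fun k l h => AddSubgroup.card_dvd_of_le (hmono h)
  have hM0 : M 0 = 1 := by simp [hM, h0]
  -- A mixed radix expansion with place values `M i`: dividing by `M k` forgets exactly the digits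
  -- below `k`, that is, the position inside a coset of `S k`.
  let P : ℕ → T → ℕ := fun K x => ∑ i ∈ Finset.range K, D i x * M i
  have hPs : ∀ K x, P (K + 1) x = P K x + D K x * M K := fun K x => Finset.sum_range_succ _ _
  have hPlt : ∀ K x, P K x < M K := by
    intro K x
    induction K with
    | zero => simp [P, hM0]
    | succ K ih =>
      have := hD1 K x
      rw [hPs]
      change M K * (D K x + 1) ≤ M (K + 1) at this
      linarith
  have hPst : ∀ K L x, x ∈ S K → K ≤ L → P L x = P K x := by
    intro K L x hx hKL
    induction L, hKL using Nat.le_induction with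
    | base => rfl
    | succ L hKL ih => rw [hPs, hD2 L x (hmono hKL hx), zero_mul, add_zero, ih]
  choose κ hκ using hmem
  let β : T → ℕ := fun x => P (κ x) x
  have hβ : ∀ K x, x ∈ S K → β x = P K x := fun K x hx => by
    rcases le_total K (κ x) with h | h
    · exact hPst _ _ x hx h
    · exact (hPst _ _ x (hκ x) h).symm
  have hblock : ∀ k K, k ≤ K → ∀ x y, y - x ∈ S K → (P K x / M k = P K y / M k ↔ y - x ∈ S k) := by
    intro k K hkK
    induction K, hkK using Nat.le_induction with
    | base =>
      intro x y h
      simp [Nat.div_eq_of_lt (hPlt k x), Nat.div_eq_of_lt (hPlt k y), h]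
    | succ K hkK ih =>
      intro x y hxy
      obtain ⟨c, hc⟩ := hdvd k K hkK
      have hdiv : ∀ z, P (K + 1) z / M k = P K z / M k + D K z * c := fun z => by
        rw [hPs, hc, show D K z * (M k * c) = (D K z * c) * M k by ring,
          Nat.add_mul_div_right _ _ (hpos k)]
      have hdiv2 : ∀ z, P (K + 1) z / M k / c = D K z := fun z => by
        rw [Nat.div_div_eq_div_mul, ← hc, hPs, Nat.add_mul_div_right _ _ (hpos K),
          Nat.div_eq_of_lt (hPlt K z), zero_add]
      constructor
      · intro h
        have hDD : D K x = D K y := by rw [← hdiv2, ← hdiv2, h]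
        refine (ih x y (hD4 K x y hxy hDD)).1 ?_
        rw [hdiv, hdiv, hDD] at h
        exact Nat.add_right_cancel h
      · intro h
        rw [hdiv, hdiv, hD3 K x y (hmono hkK h), (ih x y (hmono hkK h)).2 h]
  have hmain : ∀ k x y, y - x ∈ S k ↔ β x / M k = β y / M k := by
    intro k x y
    set K := max k (max (κ x) (κ y))
    have hx : x ∈ S K := hmono (le_trans (le_max_left _ _) (le_max_right _ _)) (hκ x)
    have hy : y ∈ S K := hmono (le_trans (le_max_right _ _) (le_max_right _ _)) (hκ y)
    rw [hβ K x hx, hβ K y hy]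
    exact (hblock k K (le_max_left _ _) x y (sub_mem hy hx)).symm
  have hinj : Function.Injective β := by
    intro x y h
    have := (hmain 0 x y).2 (by rw [h])
    rw [h0, AddSubgroup.mem_bot, sub_eq_zero] at this
    exact this.symm
  have hsurj : Function.Surjective β := by
    intro n
    obtain ⟨K, hK⟩ := hunb (n + 1)
    let f : S K → Fin (M K) := fun x => ⟨β x, by rw [hβ K x x.2]; exact hPlt K x⟩
    have hf : Function.Injective f := fun x y h => Subtype.ext (hinj (Fin.mk.inj_iff.1 h))
    have hf' := ((Nat.bijective_iff_injective_and_card f).2 ⟨hf, by simp [hM]⟩).2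
    obtain ⟨x, hx⟩ := hf' ⟨n, hK⟩
    exact ⟨x, congrArg Fin.val hx⟩
  exact ⟨Equiv.ofBijective β ⟨hinj, hsurj⟩, hmain⟩

/-- Every finite set of differences lies in some subgroup of the filtration, so a map is bornologous
when it sends blocks of each level into blocks of some level. For monotone maps this only concerns
block boundaries. The maps used are the increasing function `e` and its left inverse `fl`, with `fl
q` the largest `p` such that `e p ≤ q`. -/
theorem groupCoarselyEquivalent_of_torsion (T T' : Type*) [AddCommGroup T] [AddCommGroup T']
    [Countable T] [Countable T'] [Infinite T] [Infinite T'] (hT : IsAddTorsion T)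
    (hT' : IsAddTorsion T') : GroupCoarselyEquivalent T T' := by
  obtain ⟨S, hmono, h0, hfin, hmem, hunb⟩ := exists_finite_filtration T hT
  obtain ⟨S', hmono', h0', hfin', hmem', hunb'⟩ := exists_finite_filtration T' hT'
  obtain ⟨β, hβ⟩ := exists_block_enumeration hmono h0 hfin hmem hunb
  obtain ⟨β', hβ'⟩ := exists_block_enumeration hmono' h0' hfin' hmem' hunb'
  have hpos : ∀ k, 0 < Nat.card (S k) := fun k => Nat.card_pos
  have hpos' : ∀ k, 0 < Nat.card (S' k) := fun k => Nat.card_pos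
  obtain ⟨e, e0, elt, he1, he2⟩ := exists_block_interleaving (M := fun k => Nat.card (S k))
    (M' := fun k => Nat.card (S' k)) (by simp [h0]) (by simp [h0']) hpos hpos'
    (fun k l h => AddSubgroup.card_dvd_of_le (hmono h))
    (fun k l h => AddSubgroup.card_dvd_of_le (hmono' h)) hunb hunb'
  have emono : StrictMono e := strictMono_nat_of_lt_succ elt
  choose fl hfl1 hfl2 using exists_floor_index e e0 elt
  have hfle : ∀ q, fl (e q) = q := fun q => by
    have h1 := emono.lt_iff_lt.1 (hfl2 (e q))
    have h2 := emono.le_iff_le.1 (hfl1 (e q))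
    omega
  refine ⟨fun x => β'.symm (fl (β x)), fun y => β.symm (e (β' y)),
    groupBornologous_of_singleton fun u => ?_, groupBornologous_of_singleton fun u => ?_,
    ?_, ⟨{0}, Set.finite_singleton 0, by simp [hfle]⟩⟩
  · obtain ⟨k, hk⟩ := hmem u
    obtain ⟨l, hl⟩ := he1 k
    refine ⟨S' l, Set.toFinite (S' l : Set T'), fun x y hxy => ?_⟩
    have hlt : ∀ a b, fl a / Nat.card (S' l) < fl b / Nat.card (S' l) →
        a / Nat.card (S k) < b / Nat.card (S k) := by
      intro a b hab
      obtain ⟨p, hp1, hp2⟩ := exists_mul_between_of_div_lt (hpos' l) hab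
      obtain ⟨c, hc⟩ := hl p
      refine div_lt_of_lt_mul_le (p := c) (hpos k) ?_ ?_
      · rw [← hc]
        exact (hfl2 a).trans_le (emono.monotone hp1)
      · rw [← hc]
        exact (emono.monotone hp2).trans (hfl1 b)
    have hblock := (hβ k x y).1 (hxy ▸ hk)
    refine (hβ' l _ _).2 ?_
    simp only [Equiv.apply_symm_apply]
    by_contra hne
    rcases lt_or_gt_of_ne hne with h | h
    · exact (hlt _ _ h).ne hblock
    · exact (hlt _ _ h).ne' hblock
  · obtain ⟨k, hk⟩ := hmem' u
    obtain ⟨l, hl⟩ := he2 k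
    refine ⟨S l, Set.toFinite (S l : Set T), fun x y hxy => ?_⟩
    have hlt : ∀ a b, e a / Nat.card (S l) < e b / Nat.card (S l) →
        a / Nat.card (S' k) < b / Nat.card (S' k) := by
      intro a b hab
      obtain ⟨p, hp1, hp2⟩ := exists_mul_between_of_div_lt (hpos l) hab
      obtain ⟨c, hc⟩ := hl p
      refine div_lt_of_lt_mul_le (p := c) (hpos' k) ?_ ?_
      · rw [← hc] at hp1
        exact emono.lt_iff_lt.1 hp1
      · rw [← hc] at hp2
        exact emono.le_iff_le.1 hp2
    have hblock := (hβ' k x y).1 (hxy ▸ hk)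
    refine (hβ l _ _).2 ?_
    simp only [Equiv.apply_symm_apply]
    by_contra hne
    rcases lt_or_gt_of_ne hne with h | h
    · exact (hlt _ _ h).ne hblock
    · exact (hlt _ _ h).ne' hblock
  -- As `S' 0` is trivial, every multiple of the order of `S l` is a value of `e`, so none separates
  -- `e (fl q)` from `q`.
  · obtain ⟨l, hl⟩ := he2 0
    refine ⟨S l, Set.toFinite (S l : Set T), fun x => ?_⟩
    simp only [Equiv.apply_symm_apply]
    have hle : e (fl (β x)) / Nat.card (S l) = β x / Nat.card (S l) := by
      refine le_antisymm (Nat.div_le_div_right (hfl1 _)) (not_lt.1 fun hlt => ?_)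
      obtain ⟨p, hp1, hp2⟩ := exists_mul_between_of_div_lt (hpos l) hlt
      obtain ⟨q, hq⟩ := hl p
      rw [← hq] at hp1 hp2
      have h1 := emono.lt_iff_lt.1 hp1
      have h2 := emono.lt_iff_lt.1 (hp2.trans_lt (hfl2 (β x)))
      omega
    have := (hβ l x (β.symm (e (fl (β x))))).2 (by rw [Equiv.apply_symm_apply, hle])
    exact this

/-! ### The upper bound for the asymptotic dimension. -/

/-- The quotient `(c - i) / N` jumps only on reaching the residue `i`, so a step of length at most
one that avoids this residue at both ends preserves it. -/
theorem Int.ediv_sub_eq_of_not_modEq {N i a b : ℤ} (hi : 0 ≤ i) (hiN : i < N) (hb : b % N ≠ i)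
    (ha : a % N ≠ i) (hab : |a - b| ≤ 1) : (a - i) / N = (b - i) / N := by
  have hN : 0 < N := by omega
  have key : ∀ c : ℤ, (c + 1) % N ≠ i → (c + 1 - i) / N = (c - i) / N := by
    intro c hc
    have h1 := Int.mul_ediv_add_emod (c - i) N
    have h2 := Int.emod_nonneg (c - i) hN.ne'
    have h3 := Int.emod_lt_of_pos (c - i) hN
    set q := (c - i) / N
    set r := (c - i) % N
    have hr : r + 1 ≠ N := by
      intro hr
      apply hc
      have : c + 1 = i + N * (q + 1) := by rw [mul_add]; omega
      rw [this, Int.add_mul_emod_self_left, Int.emod_eq_of_lt hi hiN]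
    have : c + 1 - i = (r + 1) + N * q := by omega
    rw [this, Int.add_mul_ediv_left _ _ hN.ne', Int.ediv_eq_zero_of_lt (by omega) (by omega),
      zero_add]
  rw [abs_le] at hab
  rcases (by omega : a = b ∨ a = b + 1 ∨ b = a + 1) with rfl | rfl | rfl
  · rfl
  · exact key b ha
  · exact (key a hb).symm

theorem finite_bounded_finsupp {ι : Type*} [Finite ι] (C : ℤ) :
    {v : ι →₀ ℤ | ∀ j, |v j| ≤ C}.Finite := by
  classical
  have := Fintype.ofFinite ι
  refine ((Set.finite_Icc (fun _ : ι => -C) fun _ => C).preimage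
    (DFunLike.coe_injective (F := ι →₀ ℤ)).injOn).subset fun v hv => ?_
  exact ⟨fun j => (abs_le.1 (hv j)).1, fun j => (abs_le.1 (hv j)).2⟩

theorem finite_closure_of_isAddTorsion {Q : Type*} [AddCommGroup Q] (hQ : IsAddTorsion Q)
    {E : Set Q} (hE : E.Finite) : Finite (AddSubgroup.closure E) := by
  have : AddGroup.FG (AddSubgroup.closure E) := by
    rw [AddGroup.fg_iff_addSubgroup_fg]
    exact ⟨hE.toFinset, by simp⟩
  exact AddCommGroup.finite_of_fg_isAddTorsion _ (hQ.addSubgroup _)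

/-- A group that is coarsely the product of `ℤ^ι` and a torsion group has asymptotic dimension at
most the cardinality of `ι`. -/
theorem asdimLE_card {G ι Q : Type*} [AddCommGroup G] [AddCommGroup Q] [Fintype ι] [MetricSpace G]
    [Countable G] [ProperSpace G] (hG : ∀ a x y : G, dist (a + x) (a + y) = dist x y)
    (hQ : IsAddTorsion Q) (h : GroupCoarselyEquivalent G ((ι →₀ ℤ) × Q)) :
    AsdimLE G (Fintype.card ι) := by
  obtain ⟨f, g, hf, hg, ⟨K, hK, hgf⟩, -⟩ := h
  intro D hD
  obtain ⟨E, hE, hfE⟩ := hf _ (finite_closedBall_of_countable hG 0 D)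
  have hEd : ∀ x y, dist x y ≤ D → f y - f x ∈ E := fun x y hxy => by
    rw [dist_eq_dist_zero_sub hG, dist_comm] at hxy
    exact hfE x y hxy
  obtain ⟨L, hL0, hL⟩ : ∃ L : ℤ, 0 < L ∧ ∀ v ∈ E, ∀ j, |v.1 j| ≤ L := by
    obtain ⟨b, hb⟩ := (hE.image fun v => ∑ j, |v.1 j|).bddAbove
    refine ⟨max b 1, by positivity, fun v hv j => le_trans ?_ ((hb ⟨v, hv, rfl⟩).trans
      (le_max_left _ _))⟩
    exact Finset.single_le_sum (f := fun j => |v.1 j|) (fun j _ => abs_nonneg _)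
      (Finset.mem_univ j)
  set Q₀ := AddSubgroup.closure (Prod.snd '' E) with hQ₀
  have hQfin : Finite Q₀ := finite_closure_of_isAddTorsion hQ (hE.image _)
  set N : ℤ := Fintype.card ι + 1 with hN
  have hN0 : 0 < N := by omega
  -- Points at distance at most `D` have `Y` differing by at most 1 in each coordinate. Colour `i`
  -- takes the points with no `Y x j` congruent to `i` modulo `N`; these fall into bounded bricks
  -- that such small moves cannot leave for another brick.
  let Y : G → ι → ℤ := fun x j => (f x).1 j / L
  have hY1 : ∀ x j, L * Y x j ≤ (f x).1 j := fun x j => Int.mul_ediv_self_le hL0.ne'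
  have hY2 : ∀ x j, (f x).1 j < L * Y x j + L := fun x j => Int.lt_mul_ediv_self_add hL0
  let good : Fin (Fintype.card ι + 1) → G → Prop := fun i x => ∀ j, Y x j % N ≠ i
  let label : Fin (Fintype.card ι + 1) → G → (ι → ℤ) × (Q ⧸ Q₀) :=
    fun i x => (fun j => (Y x j - i) / N, ((f x).2 : Q ⧸ Q₀))
  refine ⟨fun i => Set.range fun l => {x | good i x ∧ label i x = l}, fun x => ?_, ?_, ?_⟩
  -- The coordinates forbid at most as many residues as there are elements of `ι`, one fewer than
  -- the number of colours.
  · have hnot : ¬ Function.Surjective (fun j => (⟨(Y x j % N).toNat, by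
        have h1 := Int.emod_nonneg (Y x j) hN0.ne'
        have h2 := Int.emod_lt_of_pos (Y x j) hN0
        omega⟩ : Fin (Fintype.card ι + 1))) := fun hs => by
      have := Fintype.card_le_of_surjective _ hs
      simp at this
    simp only [Function.Surjective, not_forall, not_exists] at hnot
    obtain ⟨i, hi⟩ := hnot
    refine ⟨i, _, ⟨label i x, rfl⟩, fun j hj => hi j ?_, rfl⟩
    ext
    simp [hj]
  · obtain ⟨A, hA, hgA⟩ := hg ({v : ι →₀ ℤ | ∀ j, |v j| ≤ N * L} ×ˢ (Q₀ : Set Q))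
      ((finite_bounded_finsupp (ι := ι) (N * L)).prod (Set.toFinite (Q₀ : Set Q)))
    obtain ⟨R, hR⟩ := (((hA.image2 (· + ·) hK).image2 (· - ·) hK)).isBounded.subset_closedBall 0
    refine ⟨R, ?_⟩
    rintro i _ ⟨l, rfl⟩ x ⟨-, hx⟩ y ⟨-, hy⟩
    have hxy : label i x = label i y := hx.trans hy.symm
    rw [dist_eq_dist_zero_sub hG, dist_comm]
    have hsum : y - x = (g (f y) - g (f x) + (g (f x) - x)) - (g (f y) - y) := by abel
    suffices hmem : f y - f x ∈ {v : ι →₀ ℤ | ∀ j, |v j| ≤ N * L} ×ˢ (Q₀ : Set Q) by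
      rw [hsum]
      exact hR (Set.mem_image2_of_mem (Set.mem_image2_of_mem (hgA _ _ hmem) (hgf x)) (hgf y))
    refine ⟨fun j => ?_, ?_⟩
    · have h1 : (Y x j - i) / N = (Y y j - i) / N := congrFun (congrArg Prod.fst hxy) j
      have e1 := Int.mul_ediv_self_le (x := Y x j - i) (k := N) hN0.ne'
      have e2 := Int.lt_mul_ediv_self_add (x := Y x j - i) hN0
      have e3 := Int.mul_ediv_self_le (x := Y y j - i) (k := N) hN0.ne'
      have e4 := Int.lt_mul_ediv_self_add (x := Y y j - i) hN0
      rw [h1] at e1 e2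
      have f1 := hY1 x j
      have f2 := hY2 x j
      have f3 := hY1 y j
      have f4 := hY2 y j
      change |(f y).1 j - (f x).1 j| ≤ N * L
      have g1 : L * (Y x j - Y y j + 1) ≤ L * N := mul_le_mul_of_nonneg_left (by omega) hL0.le
      have g2 : L * (Y y j - Y x j + 1) ≤ L * N := mul_le_mul_of_nonneg_left (by omega) hL0.le
      rw [abs_le]
      constructor <;> linarith
    · have h2 : ((f x).2 : Q ⧸ Q₀) = (f y).2 := congrArg Prod.snd hxy
      have := QuotientAddGroup.eq.1 h2
      rwa [neg_add_eq_sub] at this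
  · rintro i _ ⟨l, rfl⟩ _ ⟨l', rfl⟩ hne x ⟨hx, rfl⟩ y ⟨hy, rfl⟩
    by_contra hlt
    have hE' := hEd x y (not_le.1 hlt).le
    refine hne (congrArg (fun l => {z | good i z ∧ label i z = l}) (Prod.ext (funext fun j => ?_) ?_))
    · refine Int.ediv_sub_eq_of_not_modEq (by omega) (by omega) (hy j) (hx j) ?_
      have h1 := hL _ hE' j
      change |(f y).1 j - (f x).1 j| ≤ L at h1
      rw [abs_le] at h1
      have f1 := hY1 x j
      have f2 := hY2 x j
      have f3 := hY1 y j
      have f4 := hY2 y j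
      have g1 : L * (Y x j - Y y j) < L * 2 := by linarith
      have g2 : L * (Y y j - Y x j) < L * 2 := by linarith
      have g3 := lt_of_mul_lt_mul_left g1 hL0.le
      have g4 := lt_of_mul_lt_mul_left g2 hL0.le
      rw [abs_le]
      constructor <;> linarith
    · refine QuotientAddGroup.eq.2 (AddSubgroup.subset_closure ⟨_, hE', ?_⟩)
      rw [neg_add_eq_sub]
      rfl

/-! ### The lower bound: products of closed one-forms on a discrete torus. -/

section

variable {H : Type*} [AddCommGroup H] {m : ℕ}

/-- The endpoint of the first `i` steps of the path that takes the steps `v j` in the order given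
by the permutation `σ`. -/
def pathPoint (v : Fin m → H) (σ : Equiv.Perm (Fin m)) (i : Fin m) : H :=
  ∑ l ∈ Finset.Iio i, v (σ l)

theorem pathPoint_mul_swap_of_le (v : Fin m → H) (σ : Equiv.Perm (Fin m)) {i j k : Fin m}
    (hij : i ≤ j) (hjk : j < k) : pathPoint v (σ * Equiv.swap j k) i = pathPoint v σ i := by
  refine Finset.sum_congr rfl fun l hl => ?_
  have hl' : l < i := Finset.mem_Iio.1 hl
  rw [Equiv.Perm.mul_apply, Equiv.swap_apply_of_ne_of_ne (hl'.trans_le hij).ne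
    ((hl'.trans_le hij).trans hjk).ne]

theorem pathPoint_mul_swap_of_lt (v : Fin m → H) (σ : Equiv.Perm (Fin m)) {i j k : Fin m}
    (hji : j < i) (hik : i < k) :
    pathPoint v (σ * Equiv.swap j k) i + v (σ j) = pathPoint v σ i + v (σ k) := by
  have hj : j ∈ Finset.Iio i := Finset.mem_Iio.2 hji
  simp only [pathPoint]
  rw [← Finset.add_sum_erase _ _ hj, ← Finset.add_sum_erase _ (fun l => v (σ l)) hj]
  have : ∀ l ∈ (Finset.Iio i).erase j, v ((σ * Equiv.swap j k) l) = v (σ l) := fun l hl => by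
    obtain ⟨h1, h2⟩ := Finset.mem_erase.1 hl
    rw [Equiv.Perm.mul_apply, Equiv.swap_apply_of_ne_of_ne h1
      ((Finset.mem_Iio.1 h2).trans hik).ne]
  rw [Finset.sum_congr rfl this, Equiv.Perm.mul_apply, Equiv.swap_apply_left]
  abel

/-- Such a permutation maps the indices up to `k` onto themselves, so only the order of these steps
can vary. -/
theorem pathPoint_add_eq_of_fixed (v : Fin m → H) (σ : Equiv.Perm (Fin m)) {k : Fin m}
    (h : ∀ i, k < i → σ i = i) : pathPoint v σ k + v (σ k) = ∑ l ∈ Finset.Iic k, v l := by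
  have h1 : pathPoint v σ k + v (σ k) = ∑ l ∈ Finset.Iic k, v (σ l) := by
    rw [pathPoint, ← Finset.Iio_insert, Finset.sum_insert (by simp), add_comm]
  have h2 : ∀ τ : Equiv.Perm (Fin m), ∑ l ∈ Finset.Iic k, v (τ l) =
      ∑ l, v (τ l) - ∑ l ∈ (Finset.Iic k)ᶜ, v (τ l) := fun τ => by
    rw [← Finset.sum_add_sum_compl (Finset.Iic k)]
    abel
  have h3 := h2 1
  simp only [Equiv.Perm.coe_one, id_eq] at h3
  rw [h1, h2, h3, Equiv.sum_comp σ v]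
  congr 1
  refine Finset.sum_congr rfl fun l hl => ?_
  rw [h l (by simpa using hl)]

/-- Products of closed discrete one-forms are closed. -/
theorem sum_sign_mul_prod_shift (v : Fin m → H) (a : Fin m → Fin m → H → ℤ) (k : Fin m)
    (hclosed : ∀ i < k, ∀ p q y, a i p y + a i q (y + v p) = a i q y + a i p (y + v q))
    (hconst : ∀ i, k < i → ∀ j y, a i j y = if i = j then 1 else 0) (x : H) :
    ∑ σ : Equiv.Perm (Fin m), (Equiv.Perm.sign σ : ℤ) *
        ∏ i ∈ Finset.univ.erase k, a i (σ i) (x + pathPoint v σ i + v (σ k)) =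
      ∑ σ : Equiv.Perm (Fin m), (Equiv.Perm.sign σ : ℤ) *
        ∏ i ∈ Finset.univ.erase k, a i (σ i) (x + pathPoint v σ i) := by
  -- The shift by `v (σ k)` is removed from one factor at a time. Factors with index above `k` are
  -- constant, so nothing changes there.
  let A : ℕ → Equiv.Perm (Fin m) → Fin m → ℤ := fun t σ i =>
    a i (σ i) (x + pathPoint v σ i + if (i : ℕ) < t then 0 else v (σ k))
  let Q : ℕ → ℤ := fun t => ∑ σ : Equiv.Perm (Fin m), (Equiv.Perm.sign σ : ℤ) *
    ∏ i ∈ Finset.univ.erase k, A t σ i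
  have hAcongr : ∀ t σ (i : Fin m), (i : ℕ) ≠ t → A (t + 1) σ i = A t σ i := fun t σ i hi => by
    have : ((i : ℕ) < t + 1) = ((i : ℕ) < t) := by rw [eq_iff_iff]; omega
    simp only [A, this]
  have hAconst : ∀ t t' σ i, k < i → A t σ i = A t' σ i := fun t t' σ i hi => by
    simp only [A, hconst i hi]
  have step : ∀ t, Q (t + 1) = Q t := by
    intro t
    by_cases ht : t < (k : ℕ)
    swap
    · refine Finset.sum_congr rfl fun σ _ => congrArg _ (Finset.prod_congr rfl fun i hi => ?_)
      rcases lt_or_gt_of_ne (Finset.ne_of_mem_erase hi) with h | h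
      · exact hAcongr t σ i (by have := Fin.lt_def.1 h; omega)
      · exact hAconst _ _ _ _ h
    let j : Fin m := ⟨t, ht.trans k.2⟩
    have hjk : j < k := ht
    have hjmem : j ∈ Finset.univ.erase k := Finset.mem_erase.2 ⟨hjk.ne, Finset.mem_univ _⟩
    let f : Equiv.Perm (Fin m) → ℤ := fun σ => (Equiv.Perm.sign σ : ℤ) *
      ((A (t + 1) σ j - A t σ j) * ∏ i ∈ (Finset.univ.erase k).erase j, A t σ i)
    have hf : Q (t + 1) - Q t = ∑ σ, f σ := by
      simp only [Q, f, ← Finset.sum_sub_distrib]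
      refine Finset.sum_congr rfl fun σ _ => ?_
      rw [← Finset.mul_prod_erase _ (A (t + 1) σ) hjmem, ← Finset.mul_prod_erase _ (A t σ) hjmem,
        Finset.prod_congr rfl fun i hi => hAcongr t σ i
          fun h => Finset.ne_of_mem_erase hi (Fin.ext h)]
      ring
    -- By closedness the change of factor `j` is symmetric in the steps `σ j` and `σ k`. Exchanging
    -- them preserves the other factors and reverses the sign, so the total change cancels.
    have hswap : ∀ σ, f (σ * Equiv.swap j k) = -f σ := by
      intro σ
      have e1 : A (t + 1) (σ * Equiv.swap j k) j - A t (σ * Equiv.swap j k) j =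
          A (t + 1) σ j - A t σ j := by
        have hp := pathPoint_mul_swap_of_le v σ (le_refl j) hjk
        have hv := hclosed j hjk (σ j) (σ k) (x + pathPoint v σ j)
        have ht1 : (j : ℕ) < t + 1 := Nat.lt_succ_self t
        have ht2 : ¬ (j : ℕ) < t := lt_irrefl t
        simp only [A, hp, ht1, ht2, if_true, if_false, add_zero, Equiv.Perm.mul_apply,
          Equiv.swap_apply_left, Equiv.swap_apply_right]
        linarith
      have e2 : ∏ i ∈ (Finset.univ.erase k).erase j, A t (σ * Equiv.swap j k) i =
          ∏ i ∈ (Finset.univ.erase k).erase j, A t σ i := by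
        refine Finset.prod_congr rfl fun i hi => ?_
        have hij := Finset.ne_of_mem_erase hi
        have hik := Finset.ne_of_mem_erase (Finset.mem_of_mem_erase hi)
        have hval : (σ * Equiv.swap j k) i = σ i := by
          rw [Equiv.Perm.mul_apply, Equiv.swap_apply_of_ne_of_ne hij hik]
        rcases lt_or_gt_of_ne hik with h | h
        · rcases lt_or_gt_of_ne hij with h' | h'
          · have hit : (i : ℕ) < t := h'
            simp only [A, hit, if_true, hval, pathPoint_mul_swap_of_le v σ h'.le hjk]
          · have hit : ¬ (i : ℕ) < t := not_lt.2 (Fin.lt_def.1 h').le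
            simp only [A, hit, if_false, hval, add_assoc]
            rw [Equiv.Perm.mul_apply, Equiv.swap_apply_right, pathPoint_mul_swap_of_lt v σ h' h]
        · simp only [A, hconst i h, hval]
      simp only [f, e1, e2, Equiv.Perm.sign_mul, Equiv.Perm.sign_swap hjk.ne]
      simp
    have hsum : ∑ σ, f σ = -∑ σ, f σ := by
      have h := Equiv.sum_comp (Equiv.mulRight (Equiv.swap j k)) f
      simp only [Equiv.coe_mulRight, hswap, Finset.sum_neg_distrib] at h
      exact h.symm
    omega
  have hQ : ∀ t, Q t = Q 0 := fun t => by
    induction t with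
    | zero => rfl
    | succ t ih => rw [step, ih]
  have h0 := hQ m
  simp only [Q, A] at h0
  simpa using h0.symm

/-- Summation by parts. The constant forms above `k` force `σ` to fix those indices, so the path
after step `k` ends at `x + W` whatever the order. Translating `x` brings the other value of `b` to
`x + W` as well, and what remains is the shift of `sum_sign_mul_prod_shift`. -/
theorem sum_prod_mul_coboundary [Fintype H] (v : Fin m → H) (a : Fin m → Fin m → H → ℤ)
    (k : Fin m)
    (hclosed : ∀ i < k, ∀ p q y, a i p y + a i q (y + v p) = a i q y + a i p (y + v q))
    (hconst : ∀ i, k < i → ∀ j y, a i j y = if i = j then 1 else 0) (b : H → ℤ) :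
    ∑ x, ∑ σ : Equiv.Perm (Fin m), (Equiv.Perm.sign σ : ℤ) *
      ((b (x + pathPoint v σ k + v (σ k)) - b (x + pathPoint v σ k)) *
        ∏ i ∈ Finset.univ.erase k, a i (σ i) (x + pathPoint v σ i)) = 0 := by
  set W := ∑ l ∈ Finset.Iic k, v l with hW
  have key : ∀ σ : Equiv.Perm (Fin m), ∑ x, (Equiv.Perm.sign σ : ℤ) *
      ((b (x + pathPoint v σ k + v (σ k)) - b (x + pathPoint v σ k)) *
        ∏ i ∈ Finset.univ.erase k, a i (σ i) (x + pathPoint v σ i)) =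
      ∑ x, (b (x + W) * ((Equiv.Perm.sign σ : ℤ) *
          ∏ i ∈ Finset.univ.erase k, a i (σ i) (x + pathPoint v σ i)) -
        b (x + W) * ((Equiv.Perm.sign σ : ℤ) *
          ∏ i ∈ Finset.univ.erase k, a i (σ i) (x + pathPoint v σ i + v (σ k)))) := by
    intro σ
    by_cases hσ : ∀ i, k < i → σ i = i
    · have hp := pathPoint_add_eq_of_fixed v σ hσ
      rw [Finset.sum_sub_distrib]
      have h2 := Equiv.sum_comp (Equiv.addRight (v (σ k))) fun x => b (x + pathPoint v σ k) *
        ((Equiv.Perm.sign σ : ℤ) *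
          ∏ i ∈ Finset.univ.erase k, a i (σ i) (x + pathPoint v σ i))
      have h3 : ∀ x, b (x + W) * ((Equiv.Perm.sign σ : ℤ) *
          ∏ i ∈ Finset.univ.erase k, a i (σ i) (x + pathPoint v σ i + v (σ k))) =
          b (x + v (σ k) + pathPoint v σ k) * ((Equiv.Perm.sign σ : ℤ) *
          ∏ i ∈ Finset.univ.erase k, a i (σ i) (x + v (σ k) + pathPoint v σ i)) := fun x => by
        rw [hW, ← hp, add_assoc x (v (σ k)), add_comm (v (σ k))]
        simp only [add_right_comm x (v (σ k))]
      simp only [Equiv.coe_addRight] at h2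
      rw [Finset.sum_congr rfl fun x _ => h3 x, h2, ← Finset.sum_sub_distrib]
      refine Finset.sum_congr rfl fun x _ => ?_
      rw [add_assoc x (pathPoint v σ k), hp]
      ring
    · push Not at hσ
      obtain ⟨i, hi, hne⟩ := hσ
      have hz : ∀ y : Fin m → H, ∏ i ∈ Finset.univ.erase k, a i (σ i) (y i) = 0 := fun y =>
        Finset.prod_eq_zero (i := i) (Finset.mem_erase.2 ⟨hi.ne', Finset.mem_univ _⟩)
          (by rw [hconst i hi, if_neg (Ne.symm hne)])
      refine Finset.sum_congr rfl fun x _ => ?_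
      rw [hz fun i => x + pathPoint v σ i, hz fun i => x + pathPoint v σ i + v (σ k)]
      ring
  rw [Finset.sum_comm, Finset.sum_congr rfl fun σ _ => key σ, Finset.sum_comm]
  refine Finset.sum_eq_zero fun x _ => ?_
  rw [Finset.sum_sub_distrib, ← Finset.mul_sum, ← Finset.mul_sum,
    sum_sign_mul_prod_shift v a k hclosed hconst x, sub_self]

/-- The integral of the product of the discrete one-forms `dxᵢ + dbᵢ` over a finite torus. -/
theorem sum_prod_closed_forms [Fintype H] (v : Fin m → H) (b : Fin m → H → ℤ) :
    ∑ x, ∑ σ : Equiv.Perm (Fin m), (Equiv.Perm.sign σ : ℤ) *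
      ∏ i, ((if i = σ i then 1 else 0) +
        (b i (x + pathPoint v σ i + v (σ i)) - b i (x + pathPoint v σ i))) = Fintype.card H := by
  -- The coboundaries are added one form at a time. At time 0 only the identity permutation
  -- contributes, one unit for each point.
  let a : ℕ → Fin m → Fin m → H → ℤ := fun t i j x =>
    (if i = j then 1 else 0) + if (i : ℕ) < t then b i (x + v j) - b i x else 0
  let Q : ℕ → ℤ := fun t => ∑ x, ∑ σ : Equiv.Perm (Fin m), (Equiv.Perm.sign σ : ℤ) *
      ∏ i, a t i (σ i) (x + pathPoint v σ i)
  have step : ∀ t < m, Q (t + 1) = Q t := by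
    intro t ht
    let k : Fin m := ⟨t, ht⟩
    have h := sum_prod_mul_coboundary v (a t) k (fun i hi p q y => by
        simp only [a, add_right_comm y (v q)]
        split_ifs <;> ring)
      (fun i hi j y => by
        have : ¬ (i : ℕ) < t := not_lt.2 (Fin.lt_def.1 hi).le
        simp [a, this]) (b k)
    rw [← sub_eq_zero, ← h]
    simp only [Q, ← Finset.sum_sub_distrib]
    refine Finset.sum_congr rfl fun x _ => Finset.sum_congr rfl fun σ _ => ?_
    rw [← Finset.mul_prod_erase _ _ (Finset.mem_univ k),
      ← Finset.mul_prod_erase _ (fun i => a t i (σ i) (x + pathPoint v σ i)) (Finset.mem_univ k)]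
    have e1 : ∀ i ∈ Finset.univ.erase k, a (t + 1) i (σ i) (x + pathPoint v σ i) =
        a t i (σ i) (x + pathPoint v σ i) := fun i hi => by
      have hne : (i : ℕ) ≠ t := fun h => Finset.ne_of_mem_erase hi (Fin.ext h)
      have : ((i : ℕ) < t + 1) = ((i : ℕ) < t) := by rw [eq_iff_iff]; omega
      simp only [a, this]
    rw [Finset.prod_congr rfl e1]
    have ht1 : (k : ℕ) < t + 1 := Nat.lt_succ_self t
    have ht2 : ¬ (k : ℕ) < t := lt_irrefl t
    simp only [a, ht1, ht2, if_true, if_false]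
    ring
  have hQ : ∀ t ≤ m, Q t = Q 0 := fun t => by
    induction t with
    | zero => intro _; rfl
    | succ t ih => intro h; rw [step t h, ih (Nat.le_of_succ_le h)]
  have hQm := hQ m le_rfl
  simp only [Q, a, Fin.is_lt, if_true] at hQm
  rw [hQm]
  simp only [Nat.not_lt_zero, if_false, add_zero]
  rw [Finset.sum_const, Finset.card_univ, nsmul_eq_mul, Finset.sum_eq_single 1]
  · simp
  · intro σ _ hσ
    obtain ⟨i, hi⟩ : ∃ i, σ i ≠ i := by
      by_contra! h
      exact hσ (Equiv.ext h)
    rw [Finset.prod_eq_zero (Finset.mem_univ i) (if_neg (Ne.symm hi)), mul_zero]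
  · simp

end

/-- A lattice that is covered by `m` families of tiles has `m` functions at bounded distance from
the coordinates such that on every unit cube one of them is constant. -/
theorem AsdimLE.exists_locally_constant_coordinates {G : Type*} [AddCommGroup G] [MetricSpace G]
    [Countable G] [ProperSpace G] (hG : ∀ a x y : G, dist (a + x) (a + y) = dist x y) {n : ℕ}
    (h : AsdimLE G n) (φ : (Fin (n + 1) → ℤ) →+ G) (hφ : Function.Injective φ) :
    ∃ (B : ℤ) (u : Fin (n + 1) → (Fin (n + 1) → ℤ) → ℤ), (∀ i y, |u i y - y i| ≤ B) ∧
      ∀ x, ∃ i, ∀ w ∈ Set.Icc 0 1, u i (x + w) = u i x := by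
  classical
  obtain ⟨D, hD⟩ := ((Set.finite_Icc (-1 : Fin (n + 1) → ℤ) 1).image φ).isBounded.subset_closedBall 0
  obtain ⟨U, hcov, ⟨R, hR⟩, hdis⟩ := h (max D 0 + 1) (by positivity)
  let p : Set G → Fin (n + 1) → ℤ := fun A => if h : ∃ a, φ a ∈ A then h.choose else 0
  have hp : ∀ A a, φ a ∈ A → φ (p A) ∈ A := fun A a ha => by
    have h : ∃ a, φ a ∈ A := ⟨a, ha⟩
    simp only [p, dif_pos h]
    exact h.choose_spec
  -- At most one tile of family `i` meets the cube of points `a` with `y - a` in `[0, 1]`, since two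
  -- such points differ by a vector with entries in `[-1, 1]`. The function `u i` reads off the
  -- coordinate of a base point of that tile, and is the plain coordinate if there is none.
  let P : Fin (n + 1) → (Fin (n + 1) → ℤ) → Set G → Prop := fun i y A =>
    A ∈ U i ∧ ∃ a, φ a ∈ A ∧ y - a ∈ Set.Icc 0 1
  have hP : ∀ i y A A', P i y A → P i y A' → A = A' := by
    rintro i y A A' ⟨hA, a, ha, h0, h1⟩ ⟨hA', a', ha', h0', h1'⟩
    by_contra hne
    have hd := hdis i A hA A' hA' hne _ ha _ ha'
    have hmem : φ (a' - a) ∈ Metric.closedBall (0 : G) D := by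
      refine hD ⟨a' - a, ⟨fun j => ?_, fun j => ?_⟩, rfl⟩ <;>
      · have e0 := h0 j
        have e1 := h1 j
        have e2 := h0' j
        have e3 := h1' j
        simp only [Pi.zero_apply, Pi.one_apply, Pi.sub_apply, Pi.neg_apply] at e0 e1 e2 e3 ⊢
        omega
    rw [map_sub, Metric.mem_closedBall, dist_comm, ← dist_eq_dist_zero_sub hG] at hmem
    linarith [le_max_left D 0]
  let u : Fin (n + 1) → (Fin (n + 1) → ℤ) → ℤ := fun i y =>
    if h : ∃ A, P i y A then p h.choose i else y i
  have hu : ∀ i y A, P i y A → u i y = p A i := fun i y A hA => by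
    have h : ∃ A, P i y A := ⟨A, hA⟩
    simp only [u, dif_pos h]
    rw [hP i y _ A h.choose_spec hA]
  obtain ⟨C, hC⟩ : ∃ C : ℤ, ∀ w, φ w ∈ Metric.closedBall (0 : G) R → ∀ j, |w j| ≤ C := by
    have hfin := (finite_closedBall_of_countable hG 0 R).preimage hφ.injOn
    obtain ⟨b, hb⟩ := (hfin.image fun w => ∑ j, |w j|).bddAbove
    refine ⟨b, fun w hw j => le_trans ?_ (hb ⟨w, hw, rfl⟩)⟩
    exact Finset.single_le_sum (f := fun j => |w j|) (fun j _ => abs_nonneg _) (Finset.mem_univ j)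
  refine ⟨max C 0 + 1, u, fun i y => ?_, fun x => ?_⟩
  · by_cases h : ∃ A, P i y A
    · obtain ⟨A, hA⟩ := h
      rw [hu i y A hA]
      obtain ⟨hAU, a, ha, h0, h1⟩ := hA
      have hd := hR i A hAU _ ha _ (hp A a ha)
      rw [dist_eq_dist_zero_sub hG, dist_comm, ← map_sub] at hd
      have e := hC _ hd i
      have e0 := h0 i
      have e1 := h1 i
      simp only [Pi.zero_apply, Pi.one_apply, Pi.sub_apply] at e e0 e1
      have e2 := le_max_left C 0
      rw [abs_le] at e ⊢
      omega
    · simp only [u, dif_neg h, sub_self, abs_zero]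
      have := le_max_right C 0
      omega
  · obtain ⟨i, A, hA, hx⟩ := hcov (φ x)
    refine ⟨i, fun w hw => ?_⟩
    rw [hu i (x + w) A ⟨hA, x, hx, by simpa using hw⟩,
      hu i x A ⟨hA, x, hx, by simp⟩]

theorem card_boundary_le (k N : ℕ) [NeZero N] :
    (Finset.univ.filter fun h : Fin (k + 1) → ZMod N => ∃ j, N ≤ (h j).val + 1).card ≤
      (k + 1) * N ^ k := by
  classical
  have hsub : (Finset.univ.filter fun h : Fin (k + 1) → ZMod N => ∃ j, N ≤ (h j).val + 1) ⊆
      Finset.univ.biUnion fun j => Finset.univ.filter fun h : Fin (k + 1) → ZMod N =>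
        N ≤ (h j).val + 1 := fun h => by simp
  refine (Finset.card_le_card hsub).trans (Finset.card_biUnion_le.trans ?_)
  have : ∀ j : Fin (k + 1), (Finset.univ.filter fun h : Fin (k + 1) → ZMod N =>
      N ≤ (h j).val + 1).card ≤ N ^ k := fun j => by
    have hc : (Finset.univ : Finset (Fin k → ZMod N)).card = N ^ k := by simp [ZMod.card]
    rw [← hc]
    refine Finset.card_le_card_of_injOn (fun h l => h (j.succAbove l)) (by simp) ?_
    intro h hh h' hh' heq
    rw [Finset.mem_coe, Finset.mem_filter] at hh hh'
    funext l
    rcases Fin.eq_self_or_eq_succAbove j l with rfl | ⟨l, rfl⟩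
    · have h1 := ZMod.val_lt (h l)
      have h2 := ZMod.val_lt (h' l)
      exact ZMod.val_injective N (by omega)
    · exact congrFun heq l
  calc _ ≤ ∑ _j : Fin (k + 1), N ^ k := Finset.sum_le_sum fun j _ => this j
    _ = _ := by simp

theorem pathPoint_single_apply {R : Type*} [AddCommGroupWithOne R] {m : ℕ}
    (σ : Equiv.Perm (Fin m)) (i j : Fin m) :
    pathPoint (fun l => (Pi.single l 1 : Fin m → R)) σ i j =
      if σ.symm j < i then 1 else 0 := by
  rw [pathPoint, Finset.sum_apply]
  have : ∀ l, (Pi.single (σ l) 1 : Fin m → R) j = if l = σ.symm j then 1 else 0 := fun l => by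
    rw [Pi.single_apply]
    congr 1
    rw [eq_iff_iff, Equiv.eq_symm_apply, eq_comm]
  simp [this]

/-- Bounded perturbations of the coordinates cannot have a constant member on every unit cube. -/
theorem not_exists_locally_constant_coordinates (k : ℕ) (B : ℤ)
    (u : Fin (k + 1) → (Fin (k + 1) → ℤ) → ℤ) (hB : ∀ i y, |u i y - y i| ≤ B) :
    ¬ ∀ x, ∃ i, ∀ w ∈ Set.Icc 0 1, u i (x + w) = u i x := by
  intro hloc
  have hB0 : 0 ≤ B := (abs_nonneg _).trans (hB 0 0)
  obtain ⟨c, rfl⟩ := Int.eq_ofNat_of_zero_le hB0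
  set K : ℕ := (k + 1).factorial * (1 + 2 * c) ^ (k + 1) with hK
  -- The total `N ^ (k + 1)` must come from the at most `(k + 1) * N ^ k` cubes that wrap around the
  -- torus, each contributing at most `K`. This `N` is the first size for which that is impossible.
  set N : ℕ := (k + 1) * K + 1 with hN
  have : NeZero N := ⟨by omega⟩
  let v : Fin (k + 1) → Fin (k + 1) → ZMod N := fun l => Pi.single l 1
  let lift : (Fin (k + 1) → ZMod N) → Fin (k + 1) → ℤ := fun h j => (h j).val
  let b : Fin (k + 1) → (Fin (k + 1) → ZMod N) → ℤ := fun i h => u i (lift h) - lift h i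
  have hb : ∀ i h, |b i h| ≤ c := fun i h => hB i _
  let ω : (Fin (k + 1) → ZMod N) → ℤ := fun x =>
    ∑ σ : Equiv.Perm (Fin (k + 1)), (Equiv.Perm.sign σ : ℤ) *
      ∏ i, ((if i = σ i then 1 else 0) +
        (b i (x + pathPoint v σ i + v (σ i)) - b i (x + pathPoint v σ i)))
  have hω : ∑ x, ω x = (N : ℤ) ^ (k + 1) := by
    refine (sum_prod_closed_forms v b).trans ?_
    simp [ZMod.card]
  have hbound : ∀ x, |ω x| ≤ K := by
    intro x
    refine (Finset.abs_sum_le_sum_abs _ _).trans ?_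
    have hle : ∀ σ : Equiv.Perm (Fin (k + 1)), |(Equiv.Perm.sign σ : ℤ) *
      ∏ i, ((if i = σ i then 1 else 0) +
        (b i (x + pathPoint v σ i + v (σ i)) - b i (x + pathPoint v σ i)))| ≤
        ((1 + 2 * c : ℕ) : ℤ) ^ (k + 1) := fun σ => by
      rw [abs_mul, Int.abs_eq_natAbs (Equiv.Perm.sign σ : ℤ), Int.units_natAbs, Nat.cast_one,
        one_mul, Finset.abs_prod]
      refine (Finset.prod_le_prod (g := fun _ => ((1 + 2 * c : ℕ) : ℤ)) (fun i _ => abs_nonneg _)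
        fun i _ => ?_).trans (by simp)
      have h1 := hb i (x + pathPoint v σ i + v (σ i))
      have h2 := hb i (x + pathPoint v σ i)
      rw [abs_le] at h1 h2 ⊢
      push_cast
      split_ifs <;> constructor <;> linarith
    refine (Finset.sum_le_sum fun σ _ => hle σ).trans (le_of_eq ?_)
    rw [Finset.sum_const, Finset.card_univ, Fintype.card_perm, Fintype.card_fin, nsmul_eq_mul, hK]
    push_cast
    ring
  -- On a cube that does not wrap around, factor `i` is the difference of `u i` along an edge. It is
  -- zero for the `i` whose `u i` is constant on the cube.
  have hinterior : ∀ x : Fin (k + 1) → ZMod N, (¬ ∃ j, N ≤ (x j).val + 1) → ω x = 0 := by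
    intro x hx
    push Not at hx
    obtain ⟨i, hi⟩ := hloc (lift x)
    have hlift : ∀ e : Fin (k + 1) → ℤ, e ∈ Set.Icc 0 1 →
        lift (x + fun j => (e j : ZMod N)) = lift x + e := by
      intro e he
      funext j
      have h0 := he.1 j
      have h1 := he.2 j
      have hj := hx j
      simp only [Pi.zero_apply, Pi.one_apply] at h0 h1
      obtain ⟨t, ht⟩ := Int.eq_ofNat_of_zero_le h0
      have hval : ((x j : ZMod N) + ((e j : ℤ) : ZMod N)).val = (x j).val + t := by
        rw [ht]
        have : (x j + ((t : ℤ) : ZMod N)) = (((x j).val + t : ℕ) : ZMod N) := by simp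
        rw [this, ZMod.val_natCast, Nat.mod_eq_of_lt (by omega)]
      change (((x j + ((e j : ℤ) : ZMod N)).val : ℕ) : ℤ) = ((x j).val : ℤ) + e j
      rw [hval, ht]
      push_cast
      rfl
    refine Finset.sum_eq_zero fun σ _ => ?_
    rw [Finset.prod_eq_zero (Finset.mem_univ i), mul_zero]
    let e : Fin (k + 1) → ℤ := pathPoint (fun l => Pi.single l 1) σ i
    let e' : Fin (k + 1) → ℤ := e + Pi.single (σ i) 1
    have he : ∀ j, e j = if σ.symm j < i then 1 else 0 := fun j => pathPoint_single_apply σ i j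
    have he' : ∀ j, e' j = e j + if j = σ i then 1 else 0 := fun j => by
      simp [e', Pi.single_apply]
    have hmem : e ∈ Set.Icc 0 1 := by
      constructor <;> intro j <;> rw [he] <;> split_ifs <;> simp
    have hmem' : e' ∈ Set.Icc 0 1 := by
      have : ∀ j, 0 ≤ e' j ∧ e' j ≤ 1 := fun j => by
        rw [he', he]
        by_cases hj : j = σ i
        · simp [hj]
        · rw [if_neg hj]
          split_ifs <;> simp
      exact ⟨fun j => (this j).1, fun j => (this j).2⟩
    have hcast : pathPoint v σ i = fun j => (e j : ZMod N) := by
      funext j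
      rw [he, pathPoint_single_apply]
      split_ifs <;> simp
    have hcast' : pathPoint v σ i + v (σ i) = fun j => (e' j : ZMod N) := by
      funext j
      rw [he', hcast]
      simp [v, Pi.single_apply]
    have h1 : b i (x + pathPoint v σ i) = u i (lift x) - (lift x + e) i := by
      simp only [b]
      rw [hcast, hlift e hmem, hi e hmem]
    have h2 : b i (x + pathPoint v σ i + v (σ i)) = u i (lift x) - (lift x + e') i := by
      simp only [b]
      rw [add_assoc, hcast', hlift e' hmem', hi e' hmem']
    rw [h1, h2, Pi.add_apply, Pi.add_apply, he']
    ring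
  have hle : (N : ℤ) ^ (k + 1) ≤ ((k + 1) * N ^ k : ℕ) * K := by
    rw [← hω, ← Finset.sum_filter_add_sum_filter_not Finset.univ
      fun h : Fin (k + 1) → ZMod N => ∃ j, N ≤ (h j).val + 1]
    rw [Finset.sum_eq_zero (s := Finset.univ.filter fun h => ¬ _)
      fun x hx => hinterior x (Finset.mem_filter.1 hx).2, add_zero]
    refine (Finset.sum_le_card_nsmul _ _ (K : ℤ) fun x _ => (le_abs_self _).trans (hbound x)).trans ?_
    rw [nsmul_eq_mul]
    exact mul_le_mul_of_nonneg_right (by exact_mod_cast card_boundary_le k N) (by positivity)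
  have hle' : N ^ k * N ≤ N ^ k * ((k + 1) * K) := by
    have : N ^ (k + 1) ≤ (k + 1) * N ^ k * K := by exact_mod_cast hle
    rw [pow_succ] at this
    linarith
  have := Nat.le_of_mul_le_mul_left hle' (pow_pos (by omega) k)
  omega

/-- A group that contains a free abelian group of rank `n + 1` has asymptotic dimension at least
`n + 1`. -/
theorem not_asdimLE_of_injective {G : Type*} [AddCommGroup G] [MetricSpace G]
    [Countable G] [ProperSpace G] (hG : ∀ a x y : G, dist (a + x) (a + y) = dist x y) {n : ℕ}
    (φ : (Fin (n + 1) → ℤ) →+ G) (hφ : Function.Injective φ) : ¬ AsdimLE G n := by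
  intro h
  obtain ⟨B, u, hB, hu⟩ := h.exists_locally_constant_coordinates hG φ hφ
  exact not_exists_locally_constant_coordinates n B u hB hu

/-! ### Proper left-invariant metrics and the group of rationals modulo integers. -/

theorem nonempty_properLeftInvariantMetric {G : Type*} [AddCommGroup G] (l : G → ℕ)
    (h0 : ∀ g, l g = 0 ↔ g = 0) (hneg : ∀ g, l (-g) = l g) (hadd : ∀ g h, l (g + h) ≤ l g + l h)
    (hfin : ∀ n, {g | l g ≤ n}.Finite) : Nonempty (ProperLeftInvariantMetric G) := by
  let M : MetricSpace G :=
    { dist := fun x y => l (y - x)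
      dist_self := fun x => by simp [(h0 0).2 rfl]
      dist_comm := fun x y => by
        rw [← hneg, neg_sub]
      dist_triangle := fun x y z => by
        rw [show z - x = (y - x) + (z - y) by abel]
        exact_mod_cast hadd _ _
      eq_of_dist_eq_zero := fun {x y} h => by
        have h' : (l (y - x) : ℝ) = 0 := h
        exact (sub_eq_zero.1 ((h0 _).1 (by exact_mod_cast h'))).symm }
  refine ⟨{ M with
    proper := ⟨fun x r => Set.Finite.isCompact ?_⟩
    left_invariant := fun a x y => ?_ }⟩
  · refine ((hfin ⌊r⌋₊).image fun g => x - g).subset fun y hy => ⟨x - y, ?_, by simp⟩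
    have h : (l (x - y) : ℝ) ≤ r := hy
    exact Nat.le_floor h
  · change (l (a + y - (a + x)) : ℝ) = l (y - x)
    rw [add_sub_add_left_eq_sub]

/-- A weighted word length: distinct weights leave only finitely many generators below any given
length. -/
theorem exists_proper_length_finsupp {ι : Type*} (w : ι → ℕ) (hw : Function.Injective w) :
    ∃ l : (ι →₀ ℤ) → ℕ, (∀ g, l g = 0 ↔ g = 0) ∧ (∀ g, l (-g) = l g) ∧
      (∀ g h, l (g + h) ≤ l g + l h) ∧ ∀ n, {g | l g ≤ n}.Finite := by
  classical
  let l : (ι →₀ ℤ) → ℕ := fun x => x.sum fun k n => (w k + 1) * n.natAbs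
  have hle : ∀ x k, (w k + 1) * (x k).natAbs ≤ l x := fun x k => by
    by_cases hk : k ∈ x.support
    · exact Finset.single_le_sum (f := fun k => (w k + 1) * (x k).natAbs)
        (fun _ _ => Nat.zero_le _) hk
    · simp [Finsupp.notMem_support_iff.1 hk]
  refine ⟨l, fun x => ⟨fun h => ?_, fun h => by simp [l, h]⟩, fun x => ?_, fun x y => ?_,
    fun n => ?_⟩
  · ext k
    have := hle x k
    rw [h, Nat.le_zero, mul_eq_zero] at this
    simpa using this
  · rw [show l (-x) = _ from Finsupp.sum_neg_index (by simp)]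
    simp [l]
  · have hs : ∀ z : ι →₀ ℤ, z.support ⊆ x.support ∪ y.support →
        l z = ∑ k ∈ x.support ∪ y.support, (w k + 1) * (z k).natAbs := fun z hz =>
      Finsupp.sum_of_support_subset _ hz _ (by simp)
    rw [hs _ Finsupp.support_add, hs x Finset.subset_union_left, hs y Finset.subset_union_right,
      ← Finset.sum_add_distrib]
    refine Finset.sum_le_sum fun k _ => ?_
    rw [← mul_add]
    exact Nat.mul_le_mul_left _ (Int.natAbs_add_le _ _)
  · have hK : {k | w k + 1 ≤ n}.Finite :=
      Set.Finite.preimage (f := w) hw.injOn ((Set.finite_Iio n).subset fun a (ha : a + 1 ≤ n) => ha)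
    let c : ι →₀ ℤ := Finsupp.indicator hK.toFinset fun _ _ => (n : ℤ)
    refine (Set.finite_Icc (-c) c).subset fun x hx => ?_
    have key : ∀ k, |x k| ≤ c k := fun k => by
      have h1 := (hle x k).trans hx
      rw [Int.abs_eq_natAbs]
      by_cases hk : w k + 1 ≤ n
      · have : c k = n := Finsupp.indicator_of_mem (by simpa using hk) _
        rw [this]
        have : (x k).natAbs ≤ (w k + 1) * (x k).natAbs := Nat.le_mul_of_pos_left _ (by omega)
        exact_mod_cast this.trans h1
      · have h2 : (x k).natAbs = 0 := by
          by_contra h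
          have : w k + 1 ≤ (w k + 1) * (x k).natAbs :=
            Nat.le_mul_of_pos_right _ (Nat.pos_of_ne_zero h)
          omega
        rw [h2]
        exact (Finsupp.indicator_of_notMem (by simpa using hk) _).ge
    exact ⟨fun k => (abs_le.1 (key k)).1, fun k => (abs_le.1 (key k)).2⟩

theorem ratModInt_exists_nsmul_eq_zero (t : RatModInt) : ∃ N : ℕ, 0 < N ∧ N • t = 0 := by
  obtain ⟨q, rfl⟩ := QuotientAddGroup.mk_surjective t
  refine ⟨q.den, q.den_pos, ?_⟩
  rw [← QuotientAddGroup.mk_nsmul, QuotientAddGroup.eq_zero_iff, AddSubgroup.mem_zmultiples_iff]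
  exact ⟨q.num, by rw [nsmul_eq_mul, Rat.den_mul_eq_num]; simp⟩

theorem ratModInt_finite_torsion {N : ℕ} (hN : 0 < N) : {t : RatModInt | N • t = 0}.Finite := by
  refine ((Set.finite_Ico 0 (N : ℤ)).image fun a : ℤ => ((a / N : ℚ) : RatModInt)).subset
    fun t ht => ?_
  obtain ⟨q, rfl⟩ := QuotientAddGroup.mk_surjective t
  rw [Set.mem_ofPred_eq, ← QuotientAddGroup.mk_nsmul, QuotientAddGroup.eq_zero_iff,
    AddSubgroup.mem_zmultiples_iff] at ht
  obtain ⟨k, hk⟩ := ht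
  have hN' : (N : ℚ) ≠ 0 := by exact_mod_cast hN.ne'
  have hN'' : (N : ℤ) ≠ 0 := by exact_mod_cast hN.ne'
  refine ⟨k % N, ⟨Int.emod_nonneg _ hN'', Int.emod_lt_of_pos _ (by exact_mod_cast hN)⟩, ?_⟩
  rw [QuotientAddGroup.eq, AddSubgroup.mem_zmultiples_iff]
  refine ⟨k / N, ?_⟩
  have h1 : ((k % N : ℤ) : ℚ) + N * ((k / N : ℤ) : ℚ) = k := by
    exact_mod_cast Int.emod_add_mul_ediv k N
  simp only [zsmul_eq_mul, nsmul_eq_mul, mul_one] at hk ⊢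
  field_simp
  linarith

/-- The length of `t` is the least `k` with `k ! • t = 0`. It vanishes only at zero because `0 ! =
1`, and its balls are finite because each torsion subgroup is. -/
theorem exists_proper_length_ratModInt :
    ∃ l : RatModInt → ℕ, (∀ g, l g = 0 ↔ g = 0) ∧ (∀ g, l (-g) = l g) ∧
      (∀ g h, l (g + h) ≤ l g + l h) ∧ ∀ n, {g | l g ≤ n}.Finite := by
  classical
  have hex : ∀ t : RatModInt, ∃ k : ℕ, k.factorial • t = 0 := fun t => by
    obtain ⟨N, hN, h⟩ := ratModInt_exists_nsmul_eq_zero t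
    obtain ⟨c, hc⟩ := Nat.dvd_factorial hN le_rfl
    exact ⟨N, by rw [hc, mul_comm, mul_nsmul', h, nsmul_zero]⟩
  have hmul : ∀ (t : RatModInt) (a b : ℕ), a ≤ b → a.factorial • t = 0 → b.factorial • t = 0 :=
    fun t a b hab h => by
      obtain ⟨c, hc⟩ := Nat.factorial_dvd_factorial hab
      rw [hc, mul_comm, mul_nsmul', h, nsmul_zero]
  refine ⟨fun t => Nat.find (hex t), fun t => ?_, fun t => ?_, fun t s => ?_, fun n => ?_⟩
  · rw [Nat.find_eq_zero]
    simp
  · simp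
  · refine Nat.find_min' _ ?_
    rw [nsmul_add, hmul t _ _ (Nat.le_add_right _ _) (Nat.find_spec (hex t)),
      hmul s _ _ (Nat.le_add_left _ _) (Nat.find_spec (hex s)), add_zero]
  · exact (ratModInt_finite_torsion n.factorial_pos).subset fun t ht =>
      hmul t _ _ ht (Nat.find_spec (hex t))

theorem isAddTorsion_ratModInt : IsAddTorsion RatModInt := fun t => by
  obtain ⟨N, hN, h⟩ := ratModInt_exists_nsmul_eq_zero t
  exact isOfFinAddOrder_iff_nsmul_eq_zero.2 ⟨N, hN, h⟩

instance countable_ratModInt : Countable RatModInt := QuotientAddGroup.mk_surjective.countable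

instance infinite_ratModInt : Infinite RatModInt := by
  refine not_finite_iff_infinite.1 fun hfin => ?_
  set N := Nat.card RatModInt
  have hN : (N : ℚ) ≠ 0 := by exact_mod_cast (Nat.card_pos (α := RatModInt)).ne'
  have h : N • (((1 / (2 * N) : ℚ) : ℚ) : RatModInt) = 0 := card_nsmul_eq_zero'
  rw [← QuotientAddGroup.mk_nsmul, QuotientAddGroup.eq_zero_iff,
    AddSubgroup.mem_zmultiples_iff] at h
  obtain ⟨k, hk⟩ := h
  simp only [zsmul_eq_mul, nsmul_eq_mul, mul_one] at hk
  field_simp at hk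
  have : k * 2 = 1 := by exact_mod_cast hk
  omega

theorem nonempty_properLeftInvariantMetric_intPow (n : ℕ∞) :
    Nonempty (ProperLeftInvariantMetric (IntPow n)) := by
  obtain ⟨l, h1, h2, h3, h4⟩ := exists_proper_length_finsupp
    (fun k : {k : ℕ // (k : ℕ∞) < n} => (k : ℕ)) Subtype.val_injective
  exact nonempty_properLeftInvariantMetric l h1 h2 h3 h4

theorem nonempty_properLeftInvariantMetric_intPow_prod (n : ℕ∞) :
    Nonempty (ProperLeftInvariantMetric (IntPow n × RatModInt)) := by
  obtain ⟨l, h1, h2, h3, h4⟩ := exists_proper_length_finsupp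
    (fun k : {k : ℕ // (k : ℕ∞) < n} => (k : ℕ)) Subtype.val_injective
  obtain ⟨l', h1', h2', h3', h4'⟩ := exists_proper_length_ratModInt
  refine nonempty_properLeftInvariantMetric (fun g => l g.1 + l' g.2) (fun g => ?_) (fun g => ?_)
    (fun g h => ?_) fun n => ?_
  · rw [Nat.add_eq_zero_iff, h1, h1', Prod.ext_iff]
    rfl
  · simp [h2, h2']
  · have := h3 g.1 h.1
    have := h3' g.2 h.2
    simp only [Prod.fst_add, Prod.snd_add]
    omega
  · refine ((h4 n).prod (h4' n)).subset fun g hg => ?_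
    have hg' : l g.1 + l' g.2 ≤ n := hg
    exact ⟨(Nat.le_add_right _ _).trans hg', (Nat.le_add_left _ _).trans hg'⟩

/-! ### Torsion-free rank and the classification. -/

theorem exists_equiv_nat_lt (I : Type*) [Countable I] :
    ∃ r : ℕ∞, Nonempty ({k : ℕ // (k : ℕ∞) < r} ≃ I) := by
  rcases finite_or_infinite I with hI | hI
  · refine ⟨(Nat.card I : ℕ), ⟨?_⟩⟩
    refine (Equiv.trans ?_ Fin.equivSubtype.symm).trans (Finite.equivFin I).symm
    exact Equiv.subtypeEquivRight fun k => Nat.cast_lt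
  · have : Infinite {k : ℕ // (k : ℕ∞) < ⊤} :=
      Infinite.of_injective (fun k : ℕ => ⟨k, ENat.natCast_lt_top k⟩) fun a b h => by simpa using h
    exact ⟨⊤, nonempty_equiv_of_countable⟩

/-- A countable abelian group contains a free abelian group with torsion quotient. -/
theorem exists_intPow_embedding (G : Type*) [AddCommGroup G] [Countable G] :
    ∃ (r : ℕ∞) (φ : IntPow r →+ G), Function.Injective φ ∧
      ∀ g, ∃ m : ℕ, m ≠ 0 ∧ m • g ∈ φ.range := by
  obtain ⟨s, hs, hmax⟩ := exists_maximal_linearIndepOn ℤ (id : G → G)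
  obtain ⟨r, ⟨e⟩⟩ := exists_equiv_nat_lt s
  have hli : LinearIndependent ℤ fun k => ((e k : s) : G) := LinearIndependent.comp hs e e.injective
  refine ⟨r, (Finsupp.linearCombination ℤ fun k => ((e k : s) : G)).toAddMonoidHom, hli,
    fun g => ?_⟩
  have hrange : ∀ x ∈ Submodule.span ℤ s,
      x ∈ (Finsupp.linearCombination ℤ fun k => ((e k : s) : G)).toAddMonoidHom.range := by
    intro x hx
    have hset : Set.range (fun k => ((e k : s) : G)) = s := by
      rw [show (fun k => ((e k : s) : G)) = Subtype.val ∘ e from rfl, Set.range_comp,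
        e.surjective.range_eq, Set.image_univ, Subtype.range_coe]
    rw [← hset, ← Finsupp.range_linearCombination] at hx
    exact hx
  by_cases hg : g ∈ s
  · exact ⟨1, one_ne_zero, by rw [one_smul]; exact hrange g (Submodule.subset_span hg)⟩
  -- Maximality of the independent set puts a nonzero multiple of every element into its span.
  · obtain ⟨a, ha, hag⟩ := hmax g hg
    rw [Set.image_id, id_eq] at hag
    refine ⟨a.natAbs, Int.natAbs_ne_zero.2 ha, ?_⟩
    rcases Int.natAbs_eq a with h | h
    · rw [← natCast_zsmul, ← h]
      exact hrange _ hag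
    · have h' : ((a.natAbs : ℕ) : ℤ) = -a := by omega
      rw [← natCast_zsmul, h', neg_smul]
      exact neg_mem (hrange _ hag)

theorem isAddTorsion_quotient {A G : Type*} [AddCommGroup A] [AddCommGroup G] (φ : A →+ G)
    (htor : ∀ g, ∃ m : ℕ, m ≠ 0 ∧ m • g ∈ φ.range) : IsAddTorsion (G ⧸ φ.range) := fun t => by
  obtain ⟨g, rfl⟩ := QuotientAddGroup.mk_surjective t
  obtain ⟨m, hm, h⟩ := htor g
  refine isOfFinAddOrder_iff_nsmul_eq_zero.2 ⟨m, Nat.pos_of_ne_zero hm, ?_⟩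
  rw [← QuotientAddGroup.mk_nsmul]
  exact (QuotientAddGroup.eq_zero_iff _).2 h

theorem AddGroup.fg_of_finite_quotient {A G : Type*} [AddCommGroup A] [AddCommGroup G]
    (φ : A →+ G) (hA : AddGroup.FG A) (hfin : Finite (G ⧸ φ.range)) : AddGroup.FG G := by
  rw [← Module.Finite.iff_addGroup_fg] at hA ⊢
  let f : A →ₗ[ℤ] G := φ.toIntLinearMap
  have : Finite (G ⧸ LinearMap.range f) := hfin
  exact Module.Finite.of_submodule_quotient (LinearMap.range f)

/-- Doubling matters in infinite rank, where the quotient by the image of `φ` itself may be trivial.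
Modulo the doubled image the basis vectors stay distinct. In finite rank, a finite quotient would
make `G` finitely generated. -/
theorem infinite_quotient_of_not_fg {ι G : Type*} [AddCommGroup G] (φ : (ι →₀ ℤ) →+ G)
    (hφ : Function.Injective φ) (hG : ¬ AddGroup.FG G) :
    Infinite (G ⧸ (φ.comp (nsmulAddMonoidHom 2)).range) := by
  classical
  rcases finite_or_infinite ι with hι | hι
  · refine not_finite_iff_infinite.1 fun hfin => hG ?_
    exact AddGroup.fg_of_finite_quotient _
      (Module.Finite.iff_addGroup_fg.1 (inferInstance : Module.Finite ℤ (ι →₀ ℤ))) hfin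
  · refine Infinite.of_injective (fun k : ι => ((φ (Finsupp.single k 1) : G) :
      G ⧸ (φ.comp (nsmulAddMonoidHom 2)).range)) fun k l hkl => ?_
    obtain ⟨a, ha⟩ := QuotientAddGroup.eq.1 hkl
    by_contra hne
    have h1 : φ (2 • a) = φ (-Finsupp.single k 1 + Finsupp.single l 1) := by
      rw [map_add, map_neg]
      exact ha
    have h2 := DFunLike.congr_fun (hφ h1) k
    simp [Ne.symm hne] at h2
    omega

theorem groupCoarselyEquivalent_intPow_of_fg {G : Type*} [AddCommGroup G] {r : ℕ∞}
    (φ : IntPow r →+ G) (hφ : Function.Injective φ)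
    (htor : ∀ g, ∃ m : ℕ, m ≠ 0 ∧ m • g ∈ φ.range) (hG : AddGroup.FG G) :
    GroupCoarselyEquivalent G (IntPow r) := by
  have : Finite (G ⧸ φ.range) :=
    AddCommGroup.finite_of_fg_isAddTorsion _ (isAddTorsion_quotient φ htor)
  exact (groupCoarselyEquivalent_prod_quotient φ hφ htor).trans
    (groupCoarselyEquivalent_prod_finite _ _)

theorem groupCoarselyEquivalent_intPow_prod_of_not_fg {G : Type*} [AddCommGroup G] [Countable G]
    {r : ℕ∞} (φ : IntPow r →+ G) (hφ : Function.Injective φ)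
    (htor : ∀ g, ∃ m : ℕ, m ≠ 0 ∧ m • g ∈ φ.range) (hG : ¬ AddGroup.FG G) :
    GroupCoarselyEquivalent G (IntPow r × RatModInt) := by
  have hinf := infinite_quotient_of_not_fg φ hφ hG
  set ψ : IntPow r →+ G := φ.comp (nsmulAddMonoidHom 2) with hψ
  have hψinj : Function.Injective ψ := fun a b h => by
    have h1 : (2 : ℕ) • a = 2 • b := hφ h
    exact nsmul_right_injective two_ne_zero h1
  have hψtor : ∀ g, ∃ m : ℕ, m ≠ 0 ∧ m • g ∈ ψ.range := fun g => by
    obtain ⟨m, hm, a, ha⟩ := htor g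
    refine ⟨2 * m, mul_ne_zero two_ne_zero hm, a, ?_⟩
    rw [mul_nsmul', ← ha, ← map_nsmul]
    rfl
  have : Countable (G ⧸ ψ.range) := QuotientAddGroup.mk_surjective.countable
  exact (groupCoarselyEquivalent_prod_quotient ψ hψinj hψtor).trans
    ((GroupCoarselyEquivalent.refl _).prod (groupCoarselyEquivalent_of_torsion _ _
      (isAddTorsion_quotient ψ hψtor) isAddTorsion_ratModInt))

/-- The asymptotic dimension of a countable abelian group is its torsion-free rank. -/
theorem asdim_eq_rank {G : Type*} [AddCommGroup G] [Countable G] [MetricSpace G] [ProperSpace G]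
    (hG : ∀ a x y : G, dist (a + x) (a + y) = dist x y) {r : ℕ∞} (φ : IntPow r →+ G)
    (hφ : Function.Injective φ) (htor : ∀ g, ∃ m : ℕ, m ≠ 0 ∧ m • g ∈ φ.range) :
    asdim G = r := by
  apply le_antisymm
  · cases r with
    | top => exact le_top
    | coe r =>
      let e : {k : ℕ // (k : ℕ∞) < (r : ℕ∞)} ≃ Fin r :=
        (Equiv.subtypeEquivRight fun k => Nat.cast_lt).trans Fin.equivSubtype.symm
      have : Fintype {k : ℕ // (k : ℕ∞) < (r : ℕ∞)} := Fintype.ofEquiv _ e.symm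
      have h := asdimLE_card hG (isAddTorsion_quotient φ htor)
        (groupCoarselyEquivalent_prod_quotient φ hφ htor)
      rw [Fintype.card_congr e, Fintype.card_fin] at h
      exact iInf₂_le r h
  · refine le_iInf₂ fun k hk => ?_
    by_contra hlt
    rw [not_le] at hlt
    let j : Fin (k + 1) → {i : ℕ // (i : ℕ∞) < r} := fun i =>
      ⟨i, lt_of_le_of_lt (by exact_mod_cast Nat.lt_succ_iff.1 i.2) hlt⟩
    have hj : Function.Injective j := fun a b h => Fin.ext (congrArg (fun x => x.1) h)
    let θ : (Fin (k + 1) → ℤ) →+ IntPow r :=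
      (Finsupp.mapDomain.addMonoidHom j).comp
        (Finsupp.linearEquivFunOnFinite ℤ ℤ (Fin (k + 1))).symm.toLinearMap.toAddMonoidHom
    have hθ : Function.Injective θ := (Finsupp.mapDomain_injective hj).comp
      (Finsupp.linearEquivFunOnFinite ℤ ℤ (Fin (k + 1))).symm.injective
    exact not_asdimLE_of_injective hG (φ.comp θ) (hφ.comp hθ) hk

theorem asdim_congr {X Y : Type*} [PseudoMetricSpace X] [PseudoMetricSpace Y]
    (h : CoarselyEquivalent X Y) : asdim X = asdim Y := by
  have : ∀ n, AsdimLE X n ↔ AsdimLE Y n := fun n =>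
    ⟨fun hX => hX.of_coarselyEquivalent h.symm, fun hY => hY.of_coarselyEquivalent h⟩
  simp only [asdim, this]

section

variable {X : Type*} [PseudoMetricSpace X] {G H : Type*} [AddCommGroup G] [AddCommGroup H]
  [Countable G]

theorem CoarselyEquivalentToGroup.largeScaleConnected_iff {d : ProperLeftInvariantMetric G}
    (h : CoarselyEquivalentToGroup X d) : LargeScaleConnected X ↔ AddGroup.FG G := by
  let _ := d.toMetricSpace
  have := d.proper
  rw [← largeScaleConnected_iff_fg d.left_invariant]
  exact ⟨fun hX => hX.of_coarselyEquivalent h,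
    fun hG => hG.of_coarselyEquivalent (CoarselyEquivalent.symm h)⟩

theorem CoarselyEquivalentToGroup.trans [Countable H] {d : ProperLeftInvariantMetric G}
    (h : CoarselyEquivalentToGroup X d) (hGH : GroupCoarselyEquivalent G H)
    (d' : ProperLeftInvariantMetric H) : CoarselyEquivalentToGroup X d' := by
  let _ := d.toMetricSpace
  have := d.proper
  let _ := d'.toMetricSpace
  have := d'.proper
  exact CoarselyEquivalent.trans h
    (hGH.coarselyEquivalent d.left_invariant d'.left_invariant)

theorem CoarselyEquivalentToGroup.asdim_eq {d : ProperLeftInvariantMetric G}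
    (h : CoarselyEquivalentToGroup X d) {r : ℕ∞} (φ : IntPow r →+ G)
    (hφ : Function.Injective φ) (htor : ∀ g, ∃ m : ℕ, m ≠ 0 ∧ m • g ∈ φ.range) :
    asdim X = r := by
  let _ := d.toMetricSpace
  have := d.proper
  rw [asdim_congr h]
  exact asdim_eq_rank d.left_invariant φ hφ htor

end

theorem corollary1 {X : Type*} [MetricSpace X] (n : ℕ∞) (hn : asdim X = n)
    {G : Type*} [AddCommGroup G] [Countable G] (d : ProperLeftInvariantMetric G)
    (hX : CoarselyEquivalentToGroup X d) :
    Nonempty (ProperLeftInvariantMetric (IntPow n)) ∧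
    Nonempty (ProperLeftInvariantMetric (IntPow n × RatModInt)) ∧
    (∀ d₁ : ProperLeftInvariantMetric (IntPow n),
      (LargeScaleConnected X → CoarselyEquivalentToGroup X d₁) ∧
      (n ≠ ⊤ → CoarselyEquivalentToGroup X d₁ → LargeScaleConnected X)) ∧
    (∀ d₂ : ProperLeftInvariantMetric (IntPow n × RatModInt),
      CoarselyEquivalentToGroup X d₂ ↔ ¬ LargeScaleConnected X) := by
  obtain ⟨r, φ, hφ, htor⟩ := exists_intPow_embedding G
  -- The asymptotic dimension of `X` determines the rank of `G`.
  obtain rfl : n = r := hn.symm.trans (hX.asdim_eq φ hφ htor)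
  refine ⟨nonempty_properLeftInvariantMetric_intPow n,
    nonempty_properLeftInvariantMetric_intPow_prod n, fun d₁ => ⟨fun hL => ?_, fun hne h => ?_⟩,
    fun d₂ => ⟨fun h hL => ?_, fun hL => ?_⟩⟩
  · exact hX.trans (groupCoarselyEquivalent_intPow_of_fg φ hφ htor
      (hX.largeScaleConnected_iff.1 hL)) d₁
  · rw [h.largeScaleConnected_iff, ← Module.Finite.iff_addGroup_fg]
    lift n to ℕ using hne
    have : Finite {k : ℕ // (k : ℕ∞) < (n : ℕ∞)} :=
      Finite.of_injective (fun k => (⟨k, Nat.cast_lt.1 k.2⟩ : Fin n)) fun a b h =>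
        Subtype.ext (congrArg Fin.val h)
    infer_instance
  -- If `X` were large scale connected, the quotient `ℚ/ℤ` would be finitely generated and torsion,
  -- hence finite.
  · have hfg := h.largeScaleConnected_iff.1 hL
    have : AddGroup.FG RatModInt :=
      AddGroup.fg_of_surjective (f := AddMonoidHom.snd (IntPow n) RatModInt) Prod.snd_surjective
    exact not_finite_iff_infinite.2 infinite_ratModInt
      (AddCommGroup.finite_of_fg_isAddTorsion _ isAddTorsion_ratModInt)
  · exact hX.trans (groupCoarselyEquivalent_intPow_prod_of_not_fg φ hφ htor
      fun hfg => hL (hX.largeScaleConnected_iff.2 hfg)) d₂
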